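/- \textbf{Setting.} A one-dimensional mean field game has the following data: a horizon $T>0$, a control space $A\subset\mathbb R$, an exponent $p\ge 1$, an initial law $\lambda\in\mathcal P(\mathbb R)$, and coefficients $b,\sigma,f:[0,T]\times\mathbb R\times\mathcal P^p(\mathbb R)\times A\to\mathbb R$ and $g:\mathbb R\times\mathcal P^p(\mathbb R)\to\mathbb R$. Here $\mathcal P^p$ denotes probability measures with finite $p$-th moment, with the $p$-Wasserstein distance. Let $\mathcal C=C([0,T];\mathbb R)$, and let $\mathcal V$ be the set of measures $q$ on $[0,T]\times A$ whose first marginal is Lebesgue measure and which satisfy $\int|a|^p\,q(dt,da)<\infty$. Let $\Omega=\mathcal V\times\mathcal C$, with coordinate maps $(\Lambda,X)$ and filtration $\mathcal F_t=\sigma(\Lambda(C):C\in\mathcal B([0,t]\times A))\otimes\sigma(X_s:s\le t)$. For $\mu\in\mathcal P^p(\mathcal C)$ with time marginals $\mu_t$, let $\mathcal R(\mu)$ be the set of $P\in\mathcal P(\Omega)$ such that $P\circ X_0^{-1}=\lambda$, $\mathbb E^P\int|a|^p\,\Lambda(dt,da)<\infty$, and, for every $\phi\in C_c^\infty(\mathbb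 R)$, $$\phi(X_t)-\int_{[0,t]\times A}\Big[b(s,X_s,\mu_s,a)\phi'(X_s)+\tfrac12\sigma^2(s,X_s,\mu_s,a)\phi''(X_s)\Big]\Lambda(ds,da)$$ is an $(\mathcal F_t)$-martingale under $P$. Let $$J(\mu,P)=\mathbb E^P\Big[g(X_T,\mu_T)+\int f(t,X_t,\mu_t,a)\,\Lambda(dt,da)\Big].$$ A \emph{relaxed MFG solution} is a law $P\in\mathcal P^p(\Omega)$ such that, with $\mu=P\circ X^{-1}$, $P$ maximizes $J(\mu,\cdot)$ over $\mathcal R(\mu)$. It is a \emph{strict MFG solution} if in addition $P(\Lambda=dt\,\delta_{\alpha_t}(da))=1$ for some $(\mathcal F_t)$-progressively measurable $A$-valued process $\alpha$ on $\Omega$. For exponents $p',p_\sigma\ge0$, consider the following assumptions, where $|m|^p:=\int|z|^p\,m(dz)$. (A) (1) $b,\sigma,f,g$ are measurable in $t$ and continuous in $(x,m,a)$. (2) There is $c_1>0$ such that $|b(t,x,m,a)-b(t,y,m,a)|+|\sigma(t,x,m,a)-\sigma(t,y,m,a)|\le c_1|x-y|$, $|b(t,x,m,a)|\le c_1\big(1+|x|+(|m|^p)^{1/p}+|a|\big)$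 and $\sigma^2(t,x,m,a)\le c_1\big(1+|x|^{p_\sigma}+(|m|^p)^{p_\sigma/p}+|a|^{p_\sigma}\big)$. (3) There are $c_2,c_3>0$ such that $|g(x,m)|\le c_2(1+|x|^p+|m|^p)$ and $-c_2(1+|x|^p+|m|^p+|a|^{p'})\le f(t,x,m,a)\le c_2(1+|x|^p+|m|^p)-c_3|a|^{p'}$. (4) $A$ is closed and nonempty. (5) $\lambda\in\mathcal P^{p'}(\mathbb R)$, $p'>p\ge\max(1,p_\sigma)$ and $p_\sigma\in[0,2]$. (Convex) For all $(t,x,m)$, the set $\{(b(t,x,m,a),\sigma^2(t,x,m,a),z):a\in A,\ z\le f(t,x,m,a)\}$ is convex. \textbf{Theorem.} Let $T>0$, let $\sigma\in\mathbb R$ be a constant, and let $\lambda\in\mathcal P^2(\mathbb R)$ satisfy $\int x\,\lambda(dx)\neq0$. Take $p'=p=2$, $A=\mathbb R$, constant volatility $\sigma$, and $$b(t,x,m,a)=a,\qquad f(t,x,m,a)=-a^2,\qquad g(x,m)=-\Big(x+c\int z\,m(dz)\Big)^2,\qquad c=-\frac{1+T}{T}.$$ Then, for every $p_\sigma\in[0,2]$,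 (A) holds except that the requirement $p'>p$ is violated; (Convex) holds; and there is neither a relaxed nor a strict MFG solution. Consequently the condition $p'>p$ cannot simply be dropped: it is not true that every one-dimensional game satisfying (Convex) and (A), with $p'>p$ replaced by $p'=p$, has a relaxed MFG solution. -/

import Mathlib

open MeasureTheory Filter Topology Set
open scoped ENNReal ContDiff

namespace RelaxedMFG

noncomputable section

/-! ### Measures with finite moments and the Wasserstein distance -/

/-- `FiniteMoment p` is the set of probability measures with finite `p`-th moment. -/
def FiniteMoment {E : Type*} [NormedAddCommGroup E] [MeasurableSpace E] (p : ℝ) :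
    Set (Measure E) :=
  {μ | IsProbabilityMeasure μ ∧ ∫⁻ x, ‖x‖ₑ ^ p ∂μ < ⊤}

/-- The `p`-Wasserstein distance on the real line, as an extended nonnegative real. -/
def wassersteinDist (p : ℝ) (μ ν : Measure ℝ) : ℝ≥0∞ :=
  (⨅ γ ∈ {γ : Measure (ℝ × ℝ) | γ.map Prod.fst = μ ∧ γ.map Prod.snd = ν},
    ∫⁻ z, edist z.1 z.2 ^ p ∂γ) ^ (1 / p)

/-- The integral, with values in the extended reals, of an extended real function: integral of the
positive part minus integral of the negative part. -/
def extIntegral {Ω : Type*} [MeasurableSpace Ω] (P : Measure Ω) (F : Ω → EReal) : EReal :=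
  ((∫⁻ w, (F w).toENNReal ∂P : ℝ≥0∞) : EReal) - ((∫⁻ w, (-F w).toENNReal ∂P : ℝ≥0∞) : EReal)

/-! ### The canonical space of control-state pairs -/

/-- The time interval `[0, T]`. -/
abbrev Time (T : ℝ) : Type := Icc (0 : ℝ) T

/-- Lebesgue measure on `[0, T]`. -/
def timeMeasure (T : ℝ) : Measure (Time T) := (volume : Measure ℝ).comap Subtype.val

/-- Continuous real functions on `[0, T]`, with the supremum norm. -/
abbrev PathSpace (T : ℝ) : Type := C(Time T, ℝ)

instance pathMeasurableSpace (T : ℝ) : MeasurableSpace (PathSpace T) := borel _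

instance pathBorelSpace (T : ℝ) : BorelSpace (PathSpace T) := ⟨rfl⟩

/-- Relaxed controls: measures on `[0, T] × A` whose time marginal is Lebesgue measure and whose
control component has finite `p`-th moment. They are realised as measures on `[0, T] × ℝ`
concentrated on `[0, T] × A`. The σ-field is the one generated by the evaluations `q ↦ q C`, which
is the Borel σ-field of the `p`-Wasserstein metric. -/
abbrev RelaxedControl (T : ℝ) (A : Set ℝ) (p : ℝ) : Type :=
  {q : Measure (Time T × ℝ) //
    q.map Prod.fst = timeMeasure T ∧ q {z | z.2 ∉ A} = 0 ∧ ∫⁻ z, ‖z.2‖ₑ ^ p ∂q < ⊤}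

/-- The canonical space; the coordinates of `w` are the relaxed control `w.1` and the state
path `w.2`. -/
abbrev Canonical (T : ℝ) (A : Set ℝ) (p : ℝ) : Type := RelaxedControl T A p × PathSpace T

/-- The σ-field generated by the masses `q C`, for measurable `C ⊆ [0, t] × A`. -/
@[reducible] def controlSigma (T : ℝ) (A : Set ℝ) (p : ℝ) (t : Time T) :
    MeasurableSpace (RelaxedControl T A p) :=
  ⨆ C ∈ {C : Set (Time T × ℝ) | MeasurableSet C ∧ C ⊆ {z | z.1 ≤ t ∧ z.2 ∈ A}},
    MeasurableSpace.comap (fun q : RelaxedControl T A p => q.1 C) inferInstance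

/-- The σ-field generated by the state up to time `t`. -/
@[reducible] def stateSigma (T : ℝ) (t : Time T) : MeasurableSpace (PathSpace T) :=
  ⨆ s ∈ Iic t, MeasurableSpace.comap (fun x : PathSpace T => x s) inferInstance

theorem controlSigma_le (T : ℝ) (A : Set ℝ) (p : ℝ) (t : Time T) :
    controlSigma T A p t ≤ (inferInstance : MeasurableSpace (RelaxedControl T A p)) := by
  refine iSup₂_le fun C hC => ?_
  exact ((Measure.measurable_coe hC.1).comp measurable_subtype_coe).comap_le

theorem controlSigma_mono (T : ℝ) (A : Set ℝ) (p : ℝ) : Monotone (controlSigma T A p) := by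
  intro s t hst
  refine iSup₂_le fun C hC => ?_
  exact le_iSup₂_of_le C ⟨hC.1, fun z hz => ⟨(hC.2 hz).1.trans hst, (hC.2 hz).2⟩⟩ le_rfl

theorem stateSigma_le (T : ℝ) (t : Time T) : stateSigma T t ≤ pathMeasurableSpace T := by
  refine iSup₂_le fun s _ => ?_
  exact (continuous_eval_const s).measurable.comap_le

theorem stateSigma_mono (T : ℝ) : Monotone (stateSigma T) := by
  intro s t hst
  exact iSup₂_le fun r hr => le_iSup₂_of_le r (le_trans hr hst) le_rfl

/-- The product filtration on the canonical space. -/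
def canonicalFiltration (T : ℝ) (A : Set ℝ) (p : ℝ) :
    Filtration (Time T) (inferInstance : MeasurableSpace (Canonical T A p)) where
  seq t := (controlSigma T A p t).prod (stateSigma T t)
  mono' _ _ hst := sup_le_sup (MeasurableSpace.comap_mono (controlSigma_mono T A p hst))
    (MeasurableSpace.comap_mono (stateSigma_mono T hst))
  le' t := sup_le_sup (MeasurableSpace.comap_mono (controlSigma_le T A p t))
    (MeasurableSpace.comap_mono (stateSigma_le T t))

/-! ### Mean field games -/

/-- The data of a mean field game with one-dimensional state, noise and control: horizon `T`,
control space `A ⊆ ℝ`, exponent `p`, initial law, drift `b`, volatility `sigma`, running reward `f`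
and terminal reward `g`. The measure argument of the coefficients is only used at probability
measures with finite `p`-th moment, and the control argument only on `A`. -/
structure MFGData (T : ℝ) where
  T_pos : 0 < T
  A : Set ℝ
  p : ℝ
  init : Measure ℝ
  b : Time T → ℝ → Measure ℝ → ℝ → ℝ
  sigma : Time T → ℝ → Measure ℝ → ℝ → ℝ
  f : Time T → ℝ → Measure ℝ → ℝ → ℝ
  g : ℝ → Measure ℝ → ℝ

namespace MFGData

variable {T : ℝ} (D : MFGData T)

/-- Time `0`. -/
def startTime : Time T := ⟨0, le_rfl, D.T_pos.le⟩

/-- Time `T`. -/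
def endTime : Time T := ⟨T, D.T_pos.le, le_rfl⟩

/-- The canonical space of the game. -/
abbrev Om : Type := Canonical T D.A D.p

/-- The time-`t` marginal of a measure on the path space. -/
def marginal (μ : Measure (PathSpace T)) (t : Time T) : Measure ℝ := μ.map (fun x => x t)

/-- The controlled generator applied to a test function `φ`. -/
def generator (φ : ℝ → ℝ) (t : Time T) (x : ℝ) (m : Measure ℝ) (a : ℝ) : ℝ :=
  D.b t x m a * deriv φ x + 1 / 2 * (D.sigma t x m a) ^ 2 * deriv (deriv φ) x

/-- The functional `φ(x_t) - ∫_{[0,t] × A} L φ(s, x_s, μ_s, a) q(ds, da)`. -/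
def mgFunctional (μ : Measure (PathSpace T)) (φ : ℝ → ℝ) (t : Time T) (w : D.Om) : ℝ :=
  φ (w.2 t) -
    ∫ z in {z : Time T × ℝ | z.1 ≤ t}, D.generator φ z.1 (w.2 z.1) (marginal μ z.1) z.2 ∂w.1.1

/-- The admissible joint laws of control-state pairs, given the measure `μ` on paths. -/
def admissible (μ : Measure (PathSpace T)) : Set (Measure D.Om) :=
  {P | IsProbabilityMeasure P ∧
    P.map (fun w => w.2 D.startTime) = D.init ∧
    ∫⁻ w, ∫⁻ z, ‖z.2‖ₑ ^ D.p ∂w.1.1 ∂P < ⊤ ∧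
    ∀ φ : ℝ → ℝ, ContDiff ℝ ∞ φ → HasCompactSupport φ →
      Martingale (D.mgFunctional μ φ) (canonicalFiltration T D.A D.p) P}

/-- The realised reward of a control-state pair. -/
def pathReward (μ : Measure (PathSpace T)) (w : D.Om) : EReal :=
  (D.g (w.2 D.endTime) (marginal μ D.endTime) : EReal) +
    extIntegral w.1.1 (fun z => (D.f z.1 (w.2 z.1) (marginal μ z.1) z.2 : EReal))

/-- The expected reward. -/
def reward (μ : Measure (PathSpace T)) (P : Measure D.Om) : EReal :=
  extIntegral P (D.pathReward μ)

/-- The optimal admissible laws. -/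
def optimal (μ : Measure (PathSpace T)) : Set (Measure D.Om) :=
  {P | P ∈ D.admissible μ ∧ ∀ P' ∈ D.admissible μ, D.reward μ P' ≤ D.reward μ P}

/-- `P` is a relaxed MFG solution: it is optimal for its own state law, and has a finite `p`-th
moment. (The moment of the control component is finite for every admissible law, so only the moment
of the state law is mentioned.) -/
def IsRelaxedSolution (P : Measure D.Om) : Prop :=
  P.map Prod.snd ∈ FiniteMoment D.p ∧ P ∈ D.optimal (P.map Prod.snd)

/-- `P` corresponds to a strict control: almost surely the relaxed control is `dt δ_{α_t}(da)` for
a progressively measurable `A`-valued process `α`. -/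
def IsStrict (P : Measure D.Om) : Prop :=
  ∃ α : Time T → D.Om → ℝ,
    IsStronglyProgressive (canonicalFiltration T D.A D.p) α ∧ (∀ t w, α t w ∈ D.A) ∧
    ∀ᵐ w ∂P, w.1.1 = (timeMeasure T).map (fun t => (t, α t w))

/-- `P` is a strict MFG solution. -/
def IsStrictSolution (P : Measure D.Om) : Prop := D.IsRelaxedSolution P ∧ D.IsStrict P

/-! ### The standing assumptions -/

/-- Joint continuity in (state, measure, control), for the `p`-Wasserstein distance in the
measure. -/
def JointlyContinuous (h : ℝ → Measure ℝ → ℝ → ℝ) : Prop :=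
  ∀ (x : ℝ) (m : Measure ℝ) (a : ℝ) (xs : ℕ → ℝ) (ms : ℕ → Measure ℝ) (as : ℕ → ℝ),
    m ∈ FiniteMoment D.p → a ∈ D.A → (∀ n, ms n ∈ FiniteMoment D.p) → (∀ n, as n ∈ D.A) →
    Tendsto xs atTop (𝓝 x) → Tendsto (fun n => wassersteinDist D.p (ms n) m) atTop (𝓝 0) →
    Tendsto as atTop (𝓝 a) → Tendsto (fun n => h (xs n) (ms n) (as n)) atTop (𝓝 (h x m a))

/-- All the standing assumptions of the existence theorem, for the exponents `p'` and `pσ`, with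
the exception of the strict inequality `p' > p`. -/
structure StandingExceptGap (p' pσ : ℝ) : Prop where
  measurable_time : ∀ x a, ∀ m ∈ FiniteMoment D.p, a ∈ D.A →
    Measurable (fun t => D.b t x m a) ∧ Measurable (fun t => D.sigma t x m a) ∧
      Measurable (fun t => D.f t x m a)
  continuous_b : ∀ t, D.JointlyContinuous (D.b t)
  continuous_sigma : ∀ t, D.JointlyContinuous (D.sigma t)
  continuous_f : ∀ t, D.JointlyContinuous (D.f t)
  continuous_g : D.JointlyContinuous (fun x m _ => D.g x m)
  state_growth : ∃ c₁ > 0, ∀ t, ∀ m ∈ FiniteMoment D.p, ∀ a ∈ D.A,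
    (∀ x y, |D.b t x m a - D.b t y m a| + |D.sigma t x m a - D.sigma t y m a| ≤ c₁ * |x - y|) ∧
    (∀ x, |D.b t x m a| ≤ c₁ * (1 + |x| + (∫ z, |z| ^ D.p ∂m) ^ (1 / D.p) + |a|)) ∧
    (∀ x, |(D.sigma t x m a) ^ 2| ≤
      c₁ * (1 + |x| ^ pσ + (∫ z, |z| ^ D.p ∂m) ^ (pσ / D.p) + |a| ^ pσ))
  reward_growth : ∃ c₂ > 0, ∃ c₃ > 0, ∀ x, ∀ m ∈ FiniteMoment D.p,
    |D.g x m| ≤ c₂ * (1 + |x| ^ D.p + ∫ z, |z| ^ D.p ∂m) ∧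
    ∀ t, ∀ a ∈ D.A,
      -(c₂ * (1 + |x| ^ D.p + (∫ z, |z| ^ D.p ∂m) + |a| ^ p')) ≤ D.f t x m a ∧
      D.f t x m a ≤ c₂ * (1 + |x| ^ D.p + ∫ z, |z| ^ D.p ∂m) - c₃ * |a| ^ p'
  control_closed : IsClosed D.A
  control_nonempty : D.A.Nonempty
  init_moment : D.init ∈ FiniteMoment p'
  exponents : 1 ≤ D.p ∧ pσ ≤ D.p ∧ 0 ≤ pσ ∧ pσ ≤ 2

/-- The Filippov-type convexity assumption. -/
def ConvexityAssumption : Prop :=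
  ∀ t x, ∀ m ∈ FiniteMoment D.p,
    Convex ℝ {y : ℝ × ℝ × ℝ | ∃ a ∈ D.A,
      y.1 = D.b t x m a ∧ y.2.1 = (D.sigma t x m a) ^ 2 ∧ y.2.2 ≤ D.f t x m a}

end MFGData

/-- The linear-quadratic game with drift `a`, constant volatility `σ`, rewards `-a²` and
`-(x + c m̄)²` with `m̄` the mean of `m` and `c = -(1 + T) / T`, controls in `ℝ`, and `p = 2`. -/
def lqGame (T : ℝ) (hT : 0 < T) (σ : ℝ) (init : Measure ℝ) : MFGData T where
  T_pos := hT
  A := univ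
  p := 2
  init := init
  b _ _ _ a := a
  sigma _ _ _ _ := σ
  f _ _ _ a := -a ^ 2
  g x m := -(x + (-(1 + T) / T) * ∫ z, z ∂m) ^ 2

end

end RelaxedMFG

namespace RelaxedMFG

/-! ### The linear-quadratic game satisfies the standing assumptions -/

/-! Non-existence follows from a first-order condition for constant deviations. Let `P` be a
solution, `M` the mean of `X_T` under `P`, `m₀` the initial mean, and `β = c M`. With the population
law frozen, the player minimises `E[(X_T + β)² + ∫ a² dΛ]`. Adding a constant `h` to the control and
`h t` to the state gives another admissible law, whose cost exceeds that of `P` by exactly `2 h K +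
h² (T² + T)`, where `K = E[T (X_T + β) + ∫ a dΛ]`. Optimality for all real `h` forces `K = 0`.
Taking means in the dynamics gives `E ∫ a dΛ = M - m₀`, so `0 = T (1 + c) M + M - m₀`. The choice of
`c` makes `T (1 + c) = -1`; the terms in `M` cancel and `m₀ = 0`, a contradiction.

The delicate point is admissibility of the shifted law (`MFGData.map_shift_mem_admissible`). The
martingale problem is posed only for test functions of the state, whereas the shift leads to the
time-dependent function `φ (x + h t)`. Over `(u, v]` that function is frozen at time `v`, and the
defect is at most a constant times `(v - u) N(u, v)` with `N` additive (`abs_shift_increment_le`).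
Repeated bisection then makes the defect vanish (`eq_zero_of_abs_sub_le_mul`, `shift_increment_eq`).
The mean dynamics (`SolvesMartingaleProblem.integral_sub_eq`) come from test functions that
approximate the identity.

(A) and (Convex) are elementary; continuity of the terminal reward uses that the mean is 1-Lipschitz
for the Wasserstein distance. -/

theorem memLp_id_of_mem_finiteMoment_two {m : Measure ℝ} (hm : m ∈ FiniteMoment 2) :
    MemLp (fun z : ℝ => z) 2 m := by
  refine ⟨by fun_prop, ?_⟩
  rw [eLpNorm_lt_top_iff_lintegral_rpow_enorm_lt_top (by norm_num) (by norm_num)]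
  simpa using hm.2

theorem sq_integral_le_integral_sq {m : Measure ℝ} (hm : m ∈ FiniteMoment 2) :
    (∫ z, z ∂m) ^ 2 ≤ ∫ z, z ^ 2 ∂m := by
  have := hm.1
  have h := ProbabilityTheory.variance_nonneg (fun z : ℝ => z) m
  rw [ProbabilityTheory.variance_eq_sub (memLp_id_of_mem_finiteMoment_two hm)] at h
  simpa using h

/-- For any coupling, the difference of the means is the integral of `z.1 - z.2`, and Cauchy–Schwarz
bounds it by the quadratic transport cost. -/
theorem edist_integral_le_wassersteinDist {μ ν : Measure ℝ} (hμ : μ ∈ FiniteMoment 2)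
    (hν : ν ∈ FiniteMoment 2) : edist (∫ z, z ∂μ) (∫ z, z ∂ν) ≤ wassersteinDist 2 μ ν := by
  have := hμ.1
  have := hν.1
  rw [wassersteinDist, one_div, ENNReal.le_rpow_inv_iff two_pos]
  refine le_iInf₂ fun γ hγ => ?_
  obtain ⟨h1, h2⟩ := hγ
  have i1 : Integrable (fun z : ℝ × ℝ => z.1) γ := by
    have := (memLp_id_of_mem_finiteMoment_two hμ).integrable one_le_two
    rw [← h1] at this
    exact this.comp_measurable measurable_fst
  have i2 : Integrable (fun z : ℝ × ℝ => z.2) γ := by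
    have := (memLp_id_of_mem_finiteMoment_two hν).integrable one_le_two
    rw [← h2] at this
    exact this.comp_measurable measurable_snd
  -- Couplings are constrained only through their marginals; total mass one is recovered from these
  -- and removes the constant factor in Hölder's inequality.
  have hγ1 : γ univ = 1 := by
    rw [← measure_univ (μ := μ), ← h1, Measure.map_apply measurable_fst .univ, preimage_univ]
  have e1 : ∫ z, z ∂μ = ∫ z, z.1 ∂γ := by
    rw [← h1, integral_map (by fun_prop) (by fun_prop)]
  have e2 : ∫ z, z ∂ν = ∫ z, z.2 ∂γ := by
    rw [← h2, integral_map (by fun_prop) (by fun_prop)]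
  rw [e1, e2, edist_eq_enorm_sub, ← integral_sub i1 i2]
  have key : ‖∫ z : ℝ × ℝ, (z.1 - z.2) ∂γ‖ₑ ≤ (∫⁻ z, edist z.1 z.2 ^ (2 : ℝ) ∂γ) ^ (1 / 2 : ℝ) := by
    refine (enorm_integral_le_lintegral_enorm _).trans ?_
    have := ENNReal.lintegral_mul_le_Lp_mul_Lq γ Real.HolderConjugate.two_two
      (f := fun z : ℝ × ℝ => ‖z.1 - z.2‖ₑ) (g := fun _ => 1) (by fun_prop) (by fun_prop)
    simpa [hγ1, edist_eq_enorm_sub] using this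
  rwa [one_div, ENNReal.le_rpow_inv_iff two_pos] at key

theorem lqGame_jointlyContinuous_terminal (T : ℝ) (hT : 0 < T) (σ : ℝ) (init : Measure ℝ) :
    (lqGame T hT σ init).JointlyContinuous (fun x m _ => (lqGame T hT σ init).g x m) := by
  intro x m a xs ms as hm _ hms _ hxs hW _
  have hmean : Tendsto (fun n => ∫ z, z ∂ms n) atTop (𝓝 (∫ z, z ∂m)) := by
    rw [tendsto_iff_edist_tendsto_0]
    exact tendsto_of_tendsto_of_tendsto_of_le_of_le tendsto_const_nhds hW (fun _ => zero_le)
      fun n => edist_integral_le_wassersteinDist (hms n) hm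
  exact ((hxs.add (hmean.const_mul _)).pow 2).neg

theorem lqGame_standingExceptGap (T : ℝ) (hT : 0 < T) (σ : ℝ) (init : Measure ℝ)
    (hinit : init ∈ FiniteMoment 2) {pσ : ℝ} (hpσ : pσ ∈ Icc (0 : ℝ) 2) :
    (lqGame T hT σ init).StandingExceptGap 2 pσ where
  measurable_time _ _ _ _ _ := ⟨measurable_const, measurable_const, measurable_const⟩
  continuous_b _ := fun _ _ _ _ _ _ _ _ _ _ _ _ h => h
  continuous_sigma _ := fun _ _ _ _ _ _ _ _ _ _ _ _ _ => tendsto_const_nhds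
  continuous_f _ := fun _ _ _ _ _ _ _ _ _ _ _ _ h => (h.pow 2).neg
  continuous_g := lqGame_jointlyContinuous_terminal T hT σ init
  state_growth := by
    refine ⟨1 + σ ^ 2, by positivity, fun t m hm a _ => ⟨fun x y => ?_, fun x => ?_, fun x => ?_⟩⟩
    · simp only [lqGame, sub_self, abs_zero, add_zero]
      positivity
    · change |a| ≤ _
      have h0 : 0 ≤ |x| + (∫ z, |z| ^ (lqGame T hT σ init).p ∂m) ^ (1 / (lqGame T hT σ init).p) := by
        positivity
      nlinarith [abs_nonneg a, sq_nonneg σ]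
    · change |σ ^ 2| ≤ _
      have h0 : 0 ≤ |x| ^ pσ + (∫ z, |z| ^ (lqGame T hT σ init).p ∂m) ^
          (pσ / (lqGame T hT σ init).p) + |a| ^ pσ := by
        positivity
      rw [abs_of_nonneg (sq_nonneg σ)]
      nlinarith [sq_nonneg σ]
  reward_growth := by
    set c : ℝ := -(1 + T) / T
    -- From `(x + c m̄)² ≤ 2 x² + 2 c² m̄²` and `m̄² ≤ ∫ z²`; the constant is also at least 1, as
    -- the lower bound on `-a²` requires.
    refine ⟨2 + 2 * c ^ 2, by positivity, 1, one_pos, fun x m hm => ?_⟩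
    have hsq := sq_integral_le_integral_sq hm
    have h0 : 0 ≤ ∫ z, z ^ 2 ∂m := (sq_nonneg _).trans hsq
    change |-(x + c * ∫ z, z ∂m) ^ 2| ≤ (2 + 2 * c ^ 2) * (1 + |x| ^ (2 : ℝ) + ∫ z, |z| ^ (2 : ℝ) ∂m) ∧
      ∀ t : Time T, ∀ a ∈ (univ : Set ℝ),
        -((2 + 2 * c ^ 2) * (1 + |x| ^ (2 : ℝ) + (∫ z, |z| ^ (2 : ℝ) ∂m) + |a| ^ (2 : ℝ))) ≤ -a ^ 2 ∧
        -a ^ 2 ≤ (2 + 2 * c ^ 2) * (1 + |x| ^ (2 : ℝ) + ∫ z, |z| ^ (2 : ℝ) ∂m) - 1 * |a| ^ (2 : ℝ)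
    simp only [Real.rpow_two, sq_abs]
    have h1 : 0 ≤ 1 + x ^ 2 + ∫ z, z ^ 2 ∂m := by positivity
    refine ⟨?_, fun t a _ => ⟨?_, ?_⟩⟩
    · rw [abs_neg, abs_of_nonneg (sq_nonneg _)]
      have h2 : (c * ∫ z, z ∂m) ^ 2 ≤ c ^ 2 * ∫ z, z ^ 2 ∂m := by
        rw [mul_pow]; gcongr
      nlinarith [sq_nonneg (x - c * ∫ z, z ∂m), sq_nonneg x, mul_nonneg (sq_nonneg c) (sq_nonneg x),
        sq_nonneg c]
    · nlinarith [sq_nonneg a, mul_nonneg (sq_nonneg c) (sq_nonneg a), mul_nonneg (sq_nonneg c) h1]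
    · nlinarith [mul_nonneg (sq_nonneg c) h1]
  control_closed := isClosed_univ
  control_nonempty := univ_nonempty
  init_moment := hinit
  exponents := ⟨one_le_two, hpσ.2, hpσ.1, hpσ.2⟩

theorem lqGame_convexityAssumption (T : ℝ) (hT : 0 < T) (σ : ℝ) (init : Measure ℝ) :
    (lqGame T hT σ init).ConvexityAssumption := by
  intro t x m _ y₁ hy₁ y₂ hy₂ u v hu hv huv
  obtain ⟨a₁, -, e₁, s₁, l₁⟩ := hy₁
  obtain ⟨a₂, -, e₂, s₂, l₂⟩ := hy₂
  -- The averaged control works: the drift is linear, the volatility constant, and `-a²` concave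
  -- with gap `u v (a₁ - a₂)²`.
  refine ⟨u * a₁ + v * a₂, mem_univ _, ?_, ?_, ?_⟩
  · simp [e₁, e₂, lqGame]
  · simp [s₁, s₂, lqGame, ← add_mul, huv]
  · change u * y₁.2.2 + v * y₂.2.2 ≤ -(u * a₁ + v * a₂) ^ 2
    change y₁.2.2 ≤ -a₁ ^ 2 at l₁
    change y₂.2.2 ≤ -a₂ ^ 2 at l₂
    obtain rfl : v = 1 - u := by linarith
    nlinarith [mul_le_mul_of_nonneg_left l₁ hu, mul_le_mul_of_nonneg_left l₂ hv,
      mul_nonneg (mul_nonneg hu hv) (sq_nonneg (a₁ - a₂))]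

/-! ### Lebesgue measure on the time interval and relaxed controls -/

theorem timeMeasure_apply {T : ℝ} (C : Set (Time T)) :
    timeMeasure T C = volume (Subtype.val '' C) :=
  (MeasurableEmbedding.subtype_coe measurableSet_Icc).comap_apply _ _

theorem timeMeasure_Ioc {T : ℝ} (u v : Time T) :
    timeMeasure T (Ioc u v) = ENNReal.ofReal (v - u) := by
  rw [timeMeasure_apply, ← Real.volume_Ioc]
  congr 1
  ext x
  constructor
  · rintro ⟨y, hy, rfl⟩
    exact hy
  · rintro ⟨h1, h2⟩
    exact ⟨⟨x, u.2.1.trans h1.le, h2.trans v.2.2⟩, ⟨h1, h2⟩, rfl⟩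

theorem timeMeasure_singleton {T : ℝ} (t : Time T) : timeMeasure T {t} = 0 := by
  simp [timeMeasure_apply]

theorem timeMeasure_univ (T : ℝ) : timeMeasure T univ = ENNReal.ofReal T := by
  rw [timeMeasure_apply, image_univ, Subtype.range_coe, Real.volume_Icc, sub_zero]

instance isFiniteMeasure_timeMeasure (T : ℝ) : IsFiniteMeasure (timeMeasure T) :=
  ⟨by rw [timeMeasure_univ]; exact ENNReal.ofReal_lt_top⟩

variable {T : ℝ} {A : Set ℝ} {p : ℝ}

theorem RelaxedControl.apply_preimage_fst (q : RelaxedControl T A p) {C : Set (Time T)}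
    (hC : MeasurableSet C) : q.1 (Prod.fst ⁻¹' C) = timeMeasure T C := by
  exact (Measure.map_apply measurable_fst hC).symm.trans (congrArg (fun m => m C) q.2.1)

theorem RelaxedControl.apply_univ (q : RelaxedControl T A p) : q.1 univ = ENNReal.ofReal T := by
  rw [← timeMeasure_univ, ← q.apply_preimage_fst .univ, preimage_univ]

instance RelaxedControl.isFiniteMeasure (q : RelaxedControl T A p) : IsFiniteMeasure q.1 :=
  ⟨by rw [q.apply_univ]; exact ENNReal.ofReal_lt_top⟩

/-- The relaxed control, as a kernel on the canonical space. -/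
noncomputable def controlKernel (T : ℝ) (A : Set ℝ) (p : ℝ) :
    ProbabilityTheory.Kernel (Canonical T A p) (Time T × ℝ) where
  toFun w := w.1.1
  measurable' := measurable_subtype_coe.comp measurable_fst

theorem controlKernel_apply (w : Canonical T A p) : controlKernel T A p w = w.1.1 := rfl

instance isFiniteKernel_controlKernel : ProbabilityTheory.IsFiniteKernel (controlKernel T A p) :=
  ⟨ENNReal.ofReal T, ENNReal.ofReal_lt_top, fun w => (w.1.apply_univ).le⟩

/-- The measure `P(dw) Λ(w)(dt, da)`. -/
noncomputable def jointMeasure (P : Measure (Canonical T A p)) :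
    Measure (Canonical T A p × (Time T × ℝ)) :=
  P.compProd (controlKernel T A p)

instance isFiniteMeasure_jointMeasure (P : Measure (Canonical T A p)) [IsFiniteMeasure P] :
    IsFiniteMeasure (jointMeasure P) := by
  unfold jointMeasure; infer_instance

theorem measurable_eval_path :
    Measurable (fun y : PathSpace T × Time T => y.1 y.2) :=
  continuous_eval.measurable

/-- Every relaxed control has Lebesgue time marginal, so once the control value is forgotten, time
is independent of the outcome. -/
theorem map_jointMeasure (P : Measure (Canonical T A p)) [IsFiniteMeasure P] :
    (jointMeasure P).map (fun y => (y.1, y.2.1)) = P.prod (timeMeasure T) := by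
  symm
  refine Measure.prod_eq fun B C hB hC => ?_
  rw [Measure.map_apply (by fun_prop) (hB.prod hC)]
  have : (fun y : Canonical T A p × (Time T × ℝ) => (y.1, y.2.1)) ⁻¹' (B ×ˢ C) =
      B ×ˢ (Prod.fst ⁻¹' C) := rfl
  rw [this, jointMeasure, Measure.compProd_apply_prod hB (measurable_fst hC)]
  simp_rw [controlKernel_apply, RelaxedControl.apply_preimage_fst _ hC]
  rw [setLIntegral_const, mul_comm]

theorem jointMeasure_real_univ_prod (P : Measure (Canonical T A p)) [IsProbabilityMeasure P]
    {u v : Time T} (huv : u ≤ v) :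
    (jointMeasure P).real (univ ×ˢ (Prod.fst ⁻¹' Ioc u v)) = v - u := by
  have h : univ ×ˢ (Prod.fst ⁻¹' Ioc u v) =
    (fun y : Canonical T A p × (Time T × ℝ) => (y.1, y.2.1)) ⁻¹' (univ ×ˢ Ioc u v) := rfl
  rw [h, measureReal_def, ← Measure.map_apply (by fun_prop) (MeasurableSet.univ.prod measurableSet_Ioc),
    map_jointMeasure, Measure.prod_prod, timeMeasure_Ioc, measure_univ, one_mul,
    ENNReal.toReal_ofReal (sub_nonneg.2 (by exact_mod_cast huv))]

theorem setIntegral_jointMeasure_time (P : Measure (Canonical T A p)) [IsFiniteMeasure P]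
    {k : Canonical T A p × Time T → ℝ} (hk : Measurable k) {K : ℝ} (hK : ∀ y, |k y| ≤ K)
    {B : Set (Canonical T A p)} (hB : MeasurableSet B) {C : Set (Time T)} (hC : MeasurableSet C) :
    ∫ y in B ×ˢ (Prod.fst ⁻¹' C), k (y.1, y.2.1) ∂jointMeasure P =
      ∫ r in C, ∫ w in B, k (w, r) ∂P ∂timeMeasure T := by
  have h : B ×ˢ (Prod.fst ⁻¹' C) =
    (fun y : Canonical T A p × (Time T × ℝ) => (y.1, y.2.1)) ⁻¹' (B ×ˢ C) := rfl
  have hint : Integrable k (P.prod (timeMeasure T)) :=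
    .of_bound hk.aestronglyMeasurable K (.of_forall hK)
  rw [h, ← setIntegral_map (hB.prod hC) hk.aestronglyMeasurable (by fun_prop), map_jointMeasure,
    ← Measure.prod_restrict, integral_prod_symm]
  rw [Measure.prod_restrict]
  exact hint.integrableOn

theorem integrable_control (P : Measure (Canonical T A p)) [IsFiniteMeasure P] (hp : 1 ≤ p)
    (hP : ∫⁻ w, ∫⁻ z, ‖z.2‖ₑ ^ p ∂w.1.1 ∂P < ⊤) :
    Integrable (fun y => y.2.2) (jointMeasure P) := by
  have hp0 : 0 < p := one_pos.trans_le hp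
  have hp' : ENNReal.ofReal p ≠ 0 := by simpa using hp0
  have h : MemLp (fun y : Canonical T A p × (Time T × ℝ) => y.2.2) (ENNReal.ofReal p)
      (jointMeasure P) := by
    refine ⟨by fun_prop, ?_⟩
    rw [eLpNorm_lt_top_iff_lintegral_rpow_enorm_lt_top hp' ENNReal.ofReal_ne_top,
      ENNReal.toReal_ofReal hp0.le, jointMeasure, Measure.lintegral_compProd (by fun_prop)]
    exact hP
  exact h.integrable (by simpa using hp)

theorem integrable_integral_control {P : Measure (Canonical T A p)} [IsFiniteMeasure P]
    {ψ : Canonical T A p × (Time T × ℝ) → ℝ} (hψ : Integrable ψ (jointMeasure P)) :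
    Integrable (fun w => ∫ z, ψ (w, z) ∂w.1.1) P := by
  rw [jointMeasure, Measure.compProd] at hψ
  simpa [controlKernel_apply] using hψ.integral_compProd

theorem integrable_compensator {P : Measure (Canonical T A p)} [IsFiniteMeasure P]
    {ψ : Canonical T A p × (Time T × ℝ) → ℝ} (hψ : Integrable ψ (jointMeasure P)) (r : Time T) :
    Integrable
      (fun w : Canonical T A p => ∫ z in {z : Time T × ℝ | z.1 ≤ r}, ψ (w, z) ∂w.1.1) P := by
  have hm : MeasurableSet {z : Time T × ℝ | z.1 ≤ r} :=
    measurableSet_le measurable_fst measurable_const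
  refine (integrable_integral_control (hψ.indicator (MeasurableSet.univ.prod hm))).congr
    (.of_forall fun w => ?_)
  beta_reduce
  rw [← integral_indicator hm]
  refine integral_congr_ae (.of_forall fun z => ?_)
  simp [indicator]

/-- This translates between the martingale property and an identity for integrals over `B ×ˢ (s,
t]`, in which no conditional expectation appears. -/
theorem setIntegral_sub_compensator (P : Measure (Canonical T A p)) [IsFiniteMeasure P]
    {k : Time T → Canonical T A p → ℝ} {ψ : Canonical T A p × (Time T × ℝ) → ℝ}
    (hk : ∀ t, Integrable (k t) P) (hψ : Integrable ψ (jointMeasure P)) {s t : Time T}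
    (hst : s ≤ t) {B : Set (Canonical T A p)} (hB : MeasurableSet B) :
    (∫ w in B, (k t w - ∫ z in {z : Time T × ℝ | z.1 ≤ t}, ψ (w, z) ∂w.1.1) ∂P) -
        ∫ w in B, (k s w - ∫ z in {z : Time T × ℝ | z.1 ≤ s}, ψ (w, z) ∂w.1.1) ∂P =
      (∫ w in B, k t w ∂P) - (∫ w in B, k s w ∂P) -
        ∫ y in B ×ˢ (Prod.fst ⁻¹' Ioc s t), ψ y ∂jointMeasure P := by
  have hm : ∀ r : Time T, MeasurableSet {z : Time T × ℝ | z.1 ≤ r} := fun r =>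
    measurableSet_le measurable_fst measurable_const
  have hint := integrable_compensator hψ
  have hset : ∀ r : Time T,
      ∫ w in B, ∫ z in {z : Time T × ℝ | z.1 ≤ r}, ψ (w, z) ∂w.1.1 ∂P =
        ∫ y in B ×ˢ {z : Time T × ℝ | z.1 ≤ r}, ψ y ∂jointMeasure P := by
    intro r
    exact (Measure.setIntegral_compProd hB (hm r) hψ.integrableOn).symm
  have hunion : B ×ˢ {z : Time T × ℝ | z.1 ≤ t} =
      B ×ˢ {z : Time T × ℝ | z.1 ≤ s} ∪ B ×ˢ (Prod.fst ⁻¹' Ioc s t) := by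
    rw [← prod_union]
    congr 1
    ext z
    simp only [mem_ofPred_eq, mem_union, mem_preimage, mem_Ioc]
    rcases le_or_gt z.1 s with h | h
    · simp [h, h.trans hst]
    · simp [h, h.not_ge]
  have hdisj : Disjoint (B ×ˢ {z : Time T × ℝ | z.1 ≤ s}) (B ×ˢ (Prod.fst ⁻¹' Ioc s t)) := by
    rw [Set.disjoint_left]
    rintro y ⟨-, h1⟩ ⟨-, h2⟩
    exact (not_lt.2 h1) h2.1
  rw [integral_sub (hk t).integrableOn (hint t).integrableOn,
    integral_sub (hk s).integrableOn (hint s).integrableOn, hset, hset, hunion,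
    setIntegral_union hdisj (hB.prod (measurable_fst measurableSet_Ioc)) hψ.integrableOn
      hψ.integrableOn]
  ring

/-! ### Shifting the control and the state -/

theorem RelaxedControl.lintegral_map_shift_le (hp : 1 ≤ p) (h : ℝ) (q : RelaxedControl T A p) :
    ∫⁻ z, ‖z.2‖ₑ ^ p ∂q.1.map (fun z => (z.1, z.2 + h)) ≤
      2 ^ (p - 1) * (∫⁻ z, ‖z.2‖ₑ ^ p ∂q.1 + ‖h‖ₑ ^ p * ENNReal.ofReal T) := by
  have hp0 : 0 ≤ p := zero_le_one.trans hp
  rw [lintegral_map (by fun_prop) (by fun_prop), ← q.apply_univ]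
  calc ∫⁻ z, ‖z.2 + h‖ₑ ^ p ∂q.1
      ≤ ∫⁻ z, 2 ^ (p - 1) * (‖z.2‖ₑ ^ p + ‖h‖ₑ ^ p) ∂q.1 := by
        refine lintegral_mono fun z => ?_
        refine (ENNReal.rpow_le_rpow (enorm_add_le _ _) hp0).trans ?_
        exact ENNReal.rpow_add_le_mul_rpow_add_rpow _ _ hp
    _ = 2 ^ (p - 1) * (∫⁻ z, ‖z.2‖ₑ ^ p ∂q.1 + ‖h‖ₑ ^ p * q.1 univ) := by
        rw [lintegral_const_mul _ (by fun_prop), lintegral_add_right _ measurable_const,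
          lintegral_const]

theorem shift_moment_bound_lt_top (hp : 1 ≤ p) (h : ℝ) {M : ℝ≥0∞} (hM : M < ⊤) :
    2 ^ (p - 1) * (M + ‖h‖ₑ ^ p * ENNReal.ofReal T) < ⊤ := by
  refine ENNReal.mul_lt_top (ENNReal.rpow_lt_top_of_nonneg (by linarith) (by simp)) ?_
  exact ENNReal.add_lt_top.2 ⟨hM, ENNReal.mul_lt_top
    (ENNReal.rpow_lt_top_of_nonneg (zero_le_one.trans hp) enorm_ne_top) ENNReal.ofReal_lt_top⟩

/-- Shift the control values by `h`. -/
noncomputable def shiftControl (hA : A = univ) (hp : 1 ≤ p) (h : ℝ) (q : RelaxedControl T A p) :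
    RelaxedControl T A p :=
  ⟨q.1.map (fun z => (z.1, z.2 + h)), by
    refine ⟨?_, by simp [hA], ?_⟩
    · rw [Measure.map_map measurable_fst (by fun_prop)]
      exact q.2.1
    · exact (q.lintegral_map_shift_le hp h).trans_lt (shift_moment_bound_lt_top hp h q.2.2.2)⟩

/-- The path `t ↦ h t`. -/
def linearPath (T h : ℝ) : PathSpace T := ⟨fun t => h * t, by fun_prop⟩

/-- Shift the control values by `h`, and the state accordingly. -/
noncomputable def shift (hA : A = univ) (hp : 1 ≤ p) (h : ℝ) (w : Canonical T A p) :
    Canonical T A p :=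
  (shiftControl hA hp h w.1, w.2 + linearPath T h)

theorem shift_snd_apply (hA : A = univ) (hp : 1 ≤ p) (h : ℝ) (w : Canonical T A p) (t : Time T) :
    (shift hA hp h w).2 t = w.2 t + h * t := rfl

theorem shift_fst (hA : A = univ) (hp : 1 ≤ p) (h : ℝ) (w : Canonical T A p) :
    (shift hA hp h w).1.1 = w.1.1.map (fun z => (z.1, z.2 + h)) := rfl

theorem measurable_shift (hA : A = univ) (hp : 1 ≤ p) (h : ℝ) :
    Measurable (shift hA hp h : Canonical T A p → Canonical T A p) := by
  refine Measurable.prodMk (Measurable.subtype_mk ?_) ?_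
  · exact (Measure.measurable_map _ (by fun_prop)).comp (measurable_subtype_coe.comp measurable_fst)
  · exact (continuous_add_const (linearPath T h)).measurable.comp measurable_snd

theorem measurableEmbedding_shift_control (h : ℝ) :
    MeasurableEmbedding (fun z : Time T × ℝ => (z.1, z.2 + h)) :=
  MeasurableEmbedding.id.prodMap (measurableEmbedding_addRight h)

/-- The shift is non-anticipating: the shifted control charges `C` with the mass given to a
translate of `C` over the same times, and each `X_r` moves by a deterministic constant. -/
theorem measurableSet_preimage_shift (hA : A = univ) (hp : 1 ≤ p) (h : ℝ) (t : Time T)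
    {B : Set (Canonical T A p)} (hB : MeasurableSet[canonicalFiltration T A p t] B) :
    MeasurableSet[canonicalFiltration T A p t] (shift hA hp h ⁻¹' B) := by
  suffices H : (canonicalFiltration T A p t : MeasurableSpace (Canonical T A p)).comap
      (shift hA hp h) ≤ canonicalFiltration T A p t from H _ ⟨B, hB, rfl⟩
  have hF : (canonicalFiltration T A p t : MeasurableSpace (Canonical T A p)) =
    (controlSigma T A p t).comap Prod.fst ⊔ (stateSigma T t).comap Prod.snd := rfl
  rw [hF, MeasurableSpace.comap_sup]
  refine sup_le_sup ?_ ?_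
  · rw [MeasurableSpace.comap_comp]
    simp only [controlSigma, MeasurableSpace.comap_iSup, MeasurableSpace.comap_comp]
    refine iSup₂_le fun C hC => ?_
    have hC' : MeasurableSet ((fun z : Time T × ℝ => (z.1, z.2 + h)) ⁻¹' C) :=
      (measurableEmbedding_shift_control h).measurable hC.1
    refine le_iSup₂_of_le ((fun z : Time T × ℝ => (z.1, z.2 + h)) ⁻¹' C)
      ⟨hC', fun z hz => ⟨(hC.2 hz).1, hA ▸ mem_univ _⟩⟩ (le_of_eq ?_)
    congr 1
    ext w
    exact Measure.map_apply (measurableEmbedding_shift_control h).measurable hC.1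
  · rw [MeasurableSpace.comap_comp]
    simp only [stateSigma, MeasurableSpace.comap_iSup, MeasurableSpace.comap_comp]
    refine iSup₂_le fun r hr => le_iSup₂_of_le r hr ?_
    have : ((fun x : PathSpace T => x r) ∘ Prod.snd ∘ shift hA hp h) =
        (fun x : ℝ => x + h * r) ∘ ((fun x : PathSpace T => x r) ∘
          (Prod.snd : Canonical T A p → PathSpace T)) := rfl
    rw [this, ← MeasurableSpace.comap_comp]
    exact MeasurableSpace.comap_mono (measurable_add_const _).comap_le

/-! ### Test functions -/

/-- Smooth functions with compact support. -/
structure TestFunction (φ : ℝ → ℝ) : Prop where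
  contDiff : ContDiff ℝ ∞ φ
  hasCompactSupport : HasCompactSupport φ

namespace TestFunction

variable {φ : ℝ → ℝ}

theorem continuous (hφ : TestFunction φ) : Continuous φ := hφ.contDiff.continuous

theorem differentiable (hφ : TestFunction φ) : Differentiable ℝ φ :=
  hφ.contDiff.differentiable (by simp)

theorem deriv (hφ : TestFunction φ) : TestFunction (deriv φ) :=
  ⟨(contDiff_infty_iff_deriv.1 hφ.contDiff).2, hφ.hasCompactSupport.deriv⟩

theorem comp_add_const (hφ : TestFunction φ) (c : ℝ) : TestFunction (fun x => φ (x + c)) :=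
  ⟨hφ.contDiff.comp (by fun_prop),
    hφ.hasCompactSupport.comp_homeomorph (Homeomorph.addRight c)⟩

theorem exists_bound (hφ : TestFunction φ) : ∃ C, ∀ x, |φ x| ≤ C :=
  hφ.hasCompactSupport.exists_bound_of_continuous hφ.continuous

theorem abs_sub_le (hφ : TestFunction φ) {C : ℝ} (hC : ∀ x, |_root_.deriv φ x| ≤ C) (x y : ℝ) :
    |φ y - φ x| ≤ C * |y - x| :=
  convex_univ.norm_image_sub_le_of_norm_deriv_le (fun z _ => hφ.differentiable z)
    (fun z _ => hC z) (mem_univ x) (mem_univ y)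

/-- Mean value inequality for `z ↦ φ z - z φ'(y)`, whose derivative between `x` and `y` is at most
`C |y - x|`. The expansion is at `y` because test functions are later frozen at the right end of a
time interval. -/
theorem abs_sub_sub_le (hφ : TestFunction φ) {C : ℝ}
    (hC : ∀ x, |_root_.deriv (_root_.deriv φ) x| ≤ C) (x y : ℝ) :
    |φ y - φ x - (y - x) * _root_.deriv φ y| ≤ C * |y - x| ^ 2 := by
  have hd : ∀ z, HasDerivAt (fun z => φ z - z * _root_.deriv φ y)
      (_root_.deriv φ z - 1 * _root_.deriv φ y) z := fun z =>
    (hφ.differentiable z).hasDerivAt.sub ((hasDerivAt_id z).mul_const _)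
  have hC0 : 0 ≤ C := (abs_nonneg _).trans (hC 0)
  have := (convex_uIcc x y).norm_image_sub_le_of_norm_hasDerivWithin_le
    (fun z _ => (hd z).hasDerivWithinAt) (C := C * |y - x|) (fun z hz => by
      rw [one_mul]
      refine (hφ.deriv.abs_sub_le hC y z).trans ?_
      rw [abs_sub_comm]
      exact mul_le_mul_of_nonneg_left (abs_sub_right_of_mem_uIcc hz) hC0)
    left_mem_uIcc right_mem_uIcc
  calc _ = ‖φ y - y * _root_.deriv φ y - (φ x - x * _root_.deriv φ y)‖ := by
        rw [Real.norm_eq_abs]; ring_nf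
    _ ≤ C * |y - x| * |y - x| := this
    _ = _ := by ring

end TestFunction

/-! ### The martingale problem under shifts -/

/-- Bisecting `[u, v]` halves the length factor while the increments of `N` add up again, so each
bisection gains a factor 1/2. An additive `N` is used because `E ∫ |a| dΛ` over `(u, v]` need not be
of order `v - u`. -/
theorem eq_zero_of_abs_sub_le_mul {T : ℝ} {F N : Time T → ℝ} {C : ℝ} {s t : Time T} (hst : s ≤ t)
    (h : ∀ u v, s ≤ u → u ≤ v → |F v - F u| ≤ C * (v - u) * (N v - N u)) : F t = F s := by
  have key : ∀ k : ℕ, ∀ u v : Time T, s ≤ u → u ≤ v →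
      |F v - F u| ≤ (1 / 2) ^ k * (C * (v - u) * (N v - N u)) := by
    intro k
    induction k with
    | zero => simpa using h
    | succ k ih =>
      intro u v hu huv
      have huv' : (u : ℝ) ≤ v := huv
      let m : Time T := ⟨(u + v) / 2, by linarith [u.2.1, v.2.1], by linarith [u.2.2, v.2.2]⟩
      have hm : (m : ℝ) = (u + v) / 2 := rfl
      have hum : u ≤ m := by
        change (u : ℝ) ≤ m; linarith
      have hmv : m ≤ v := by
        change (m : ℝ) ≤ v; linarith
      have h1 := ih u m hu hum
      have h2 := ih m v (hu.trans hum) hmv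
      calc |F v - F u| ≤ |F v - F m| + |F m - F u| := abs_sub_le _ _ _
        _ ≤ _ := add_le_add h2 h1
        _ = _ := by rw [hm]; ring
  have hlim : Tendsto (fun k : ℕ => (1 / 2 : ℝ) ^ k * (C * (t - s) * (N t - N s))) atTop
      (𝓝 (0 * (C * (t - s) * (N t - N s)))) :=
    (tendsto_pow_atTop_nhds_zero_of_lt_one (by norm_num) (by norm_num)).mul_const _
  rw [zero_mul] at hlim
  have h0 := ge_of_tendsto' hlim fun k => key k s t le_rfl hst
  exact sub_eq_zero.1 (abs_nonpos_iff.1 h0)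

/-- The martingale problem for drift equal to the control and constant volatility, in integrated
form. -/
def SolvesMartingaleProblem (σ : ℝ) (P : Measure (Canonical T A p)) : Prop :=
  ∀ φ : ℝ → ℝ, TestFunction φ → ∀ s t : Time T, s ≤ t → ∀ B : Set (Canonical T A p),
    MeasurableSet[canonicalFiltration T A p s] B →
      (∫ w in B, φ (w.2 t) ∂P) - ∫ w in B, φ (w.2 s) ∂P =
        ∫ y in B ×ˢ (Prod.fst ⁻¹' Ioc s t), (y.2.2 * deriv φ (y.1.2 y.2.1) +
          1 / 2 * σ ^ 2 * deriv (deriv φ) (y.1.2 y.2.1)) ∂jointMeasure P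

theorem measurable_eval_state (t : Time T) : Measurable (fun w : Canonical T A p => w.2 t) :=
  (continuous_eval_const t).measurable.comp measurable_snd

theorem measurable_state :
    Measurable (fun y : Canonical T A p × (Time T × ℝ) => y.1.2 y.2.1) :=
  measurable_eval_path.comp (by fun_prop : Measurable
    (fun y : Canonical T A p × (Time T × ℝ) => (y.1.2, y.2.1)))

theorem measurable_time :
    Measurable (fun y : Canonical T A p × (Time T × ℝ) => (y.2.1 : ℝ)) := by
  fun_prop

theorem integrable_generator {P : Measure (Canonical T A p)} [IsFiniteMeasure P]
    (ha : Integrable (fun y => y.2.2) (jointMeasure P)) (σ h : ℝ)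
    {τ : Canonical T A p × (Time T × ℝ) → ℝ} (hτ : Measurable τ)
    {φ : ℝ → ℝ} (hφ : TestFunction φ) :
    Integrable (fun y => (y.2.2 + h) * deriv φ (τ y) + 1 / 2 * σ ^ 2 * deriv (deriv φ) (τ y))
      (jointMeasure P) := by
  obtain ⟨C₁, h₁⟩ := hφ.deriv.exists_bound
  obtain ⟨C₂, h₂⟩ := hφ.deriv.deriv.exists_bound
  exact ((ha.add (integrable_const h)).mul_bdd
    (hφ.deriv.continuous.measurable.comp hτ).aestronglyMeasurable (.of_forall fun y => h₁ (τ y))).add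
    ((Integrable.of_bound (hφ.deriv.deriv.continuous.measurable.comp hτ).aestronglyMeasurable C₂
      (.of_forall fun y => h₂ (τ y))).const_mul _)

theorem abs_setIntegral_le_of_le {P : Measure (Canonical T A p)}
    {k ρ : Canonical T A p × (Time T × ℝ) → ℝ} {I J : Set (Time T × ℝ)} (hI : MeasurableSet I)
    (hIJ : I ⊆ J)
    {B : Set (Canonical T A p)} (hB : MeasurableSet B) (hρ : Integrable ρ (jointMeasure P))
    (hρ0 : ∀ y, 0 ≤ ρ y) (hk : ∀ y, y.2 ∈ I → |k y| ≤ ρ y) :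
    |∫ y in B ×ˢ I, k y ∂jointMeasure P| ≤ ∫ y in univ ×ˢ J, ρ y ∂jointMeasure P := by
  refine (norm_integral_le_of_norm_le (μ := (jointMeasure P).restrict (B ×ˢ I)) (f := k) (g := ρ)
    hρ.integrableOn ?_).trans ?_
  · filter_upwards [ae_restrict_mem (hB.prod hI)] with y hy
    exact hk y hy.2
  · exact setIntegral_mono_set hρ.integrableOn (.of_forall hρ0)
      (prod_mono (subset_univ _) hIJ).eventuallyLE

/-! ### Error of the shifted martingale problem over one time interval. -/

section Error

variable {P : Measure (Canonical T A p)} [IsProbabilityMeasure P] {σ h C : ℝ} {φ : ℝ → ℝ}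

theorem integrable_weight (ha : Integrable (fun y => y.2.2) (jointMeasure P)) (σ h : ℝ) :
    Integrable (fun y => |y.2.2| + |h| + 1 / 2 * σ ^ 2) (jointMeasure P) :=
  (ha.abs.add (integrable_const _)).add (integrable_const _)

theorem mul_le_integral_weight (ha : Integrable (fun y => y.2.2) (jointMeasure P)) (σ h : ℝ)
    {u v : Time T} (huv : u ≤ v) :
    |h| * (v - u) ≤ ∫ y in univ ×ˢ (Prod.fst ⁻¹' Ioc u v),
      (|y.2.2| + |h| + 1 / 2 * σ ^ 2) ∂jointMeasure P := by
  calc |h| * (v - u) = ∫ y in univ ×ˢ (Prod.fst ⁻¹' Ioc u v), |h| ∂jointMeasure P := by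
        rw [setIntegral_const, jointMeasure_real_univ_prod P huv, smul_eq_mul, mul_comm]
    _ ≤ _ := by
        refine integral_mono (integrable_const _) (integrable_weight ha σ h).integrableOn fun y => ?_
        have := abs_nonneg y.2.2
        have := sq_nonneg σ
        change |h| ≤ |y.2.2| + |h| + 1 / 2 * σ ^ 2
        linarith

/-- Cost of freezing the shift at time `v` inside the generator: the arguments differ by at most
`|h| (v - u)`, and `φ'` and `φ''` are `C`-Lipschitz. -/
theorem abs_integral_frozen_sub_le (ha : Integrable (fun y => y.2.2) (jointMeasure P))
    (hφ : TestFunction φ) (h1 : ∀ x, |deriv φ x| ≤ C) (h2 : ∀ x, |deriv (deriv φ) x| ≤ C)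
    (h3 : ∀ x, |deriv (deriv (deriv φ)) x| ≤ C) {u v : Time T} (huv : u ≤ v)
    {B : Set (Canonical T A p)} (hB : MeasurableSet B) :
    |(∫ y in B ×ˢ (Prod.fst ⁻¹' Ioc u v), ((y.2.2 + h) * deriv φ (y.1.2 y.2.1 + h * v) +
          1 / 2 * σ ^ 2 * deriv (deriv φ) (y.1.2 y.2.1 + h * v)) ∂jointMeasure P) -
      ∫ y in B ×ˢ (Prod.fst ⁻¹' Ioc u v), ((y.2.2 + h) * deriv φ (y.1.2 y.2.1 + h * y.2.1) +
          1 / 2 * σ ^ 2 * deriv (deriv φ) (y.1.2 y.2.1 + h * y.2.1)) ∂jointMeasure P| ≤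
      C * |h| * (v - u) * ∫ y in univ ×ˢ (Prod.fst ⁻¹' Ioc u v),
        (|y.2.2| + |h| + 1 / 2 * σ ^ 2) ∂jointMeasure P := by
  have m0 := measurable_state (T := T) (A := A) (p := p)
  have m1 := measurable_time (T := T) (A := A) (p := p)
  have hC0 : 0 ≤ C := (abs_nonneg _).trans (h1 0)
  have huv' : (u : ℝ) ≤ v := huv
  rw [← integral_sub
    (integrable_generator (τ := fun y => y.1.2 y.2.1 + h * v) ha σ h (by fun_prop) hφ).integrableOn
    (integrable_generator (τ := fun y => y.1.2 y.2.1 + h * y.2.1) ha σ h (by fun_prop)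
      hφ).integrableOn,
    ← integral_const_mul]
  refine abs_setIntegral_le_of_le (measurable_fst measurableSet_Ioc) subset_rfl hB ((integrable_weight ha σ h).const_mul _)
    (fun y => ?_) (fun y hy => ?_)
  · have := sub_nonneg.2 huv'
    positivity
  · set x := y.1.2 y.2.1
    have hr : (u : ℝ) < y.2.1 ∧ (y.2.1 : ℝ) ≤ v := hy
    have hd : |x + h * v - (x + h * y.2.1)| ≤ |h| * (v - u) := by
      rw [show x + h * v - (x + h * y.2.1) = h * (v - y.2.1) by ring, abs_mul,
        abs_of_nonneg (sub_nonneg.2 hr.2)]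
      gcongr
      exact hr.1.le
    have d1 := (hφ.deriv.abs_sub_le h2 (x + h * y.2.1) (x + h * v)).trans
      (mul_le_mul_of_nonneg_left hd hC0)
    have d2 := (hφ.deriv.deriv.abs_sub_le h3 (x + h * y.2.1) (x + h * v)).trans
      (mul_le_mul_of_nonneg_left hd hC0)
    calc _ = |(y.2.2 + h) * (deriv φ (x + h * v) - deriv φ (x + h * y.2.1)) + 1 / 2 * σ ^ 2 *
          (deriv (deriv φ) (x + h * v) - deriv (deriv φ) (x + h * y.2.1))| := by ring_nf
      _ ≤ |y.2.2 + h| * |deriv φ (x + h * v) - deriv φ (x + h * y.2.1)| + 1 / 2 * σ ^ 2 *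
          |deriv (deriv φ) (x + h * v) - deriv (deriv φ) (x + h * y.2.1)| := by
          refine (abs_add_le _ _).trans_eq ?_
          rw [abs_mul, abs_mul, abs_of_nonneg (by positivity : 0 ≤ 1 / 2 * σ ^ 2)]
      _ ≤ (|y.2.2| + |h|) * (C * (|h| * (v - u))) + 1 / 2 * σ ^ 2 * (C * (|h| * (v - u))) := by
          gcongr
          exact abs_add_le _ _
      _ = _ := by ring

theorem abs_integral_taylor_le (hφ : TestFunction φ) (h1 : ∀ x, |deriv φ x| ≤ C)
    (h2 : ∀ x, |deriv (deriv φ) x| ≤ C) {u v : Time T} (huv : u ≤ v)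
    (B : Set (Canonical T A p)) :
    |(∫ w in B, φ (w.2 u + h * v) ∂P) - (∫ w in B, φ (w.2 u + h * u) ∂P) -
      h * (v - u) * ∫ w in B, deriv φ (w.2 u + h * v) ∂P| ≤
      C * |h| * (v - u) * (|h| * (v - u)) := by
  have m0 := measurable_eval_state (A := A) (p := p) u
  have huv' : 0 ≤ (v : ℝ) - u := sub_nonneg.2 huv
  obtain ⟨K, hK⟩ := hφ.exists_bound
  have hC0 : 0 ≤ C := (abs_nonneg _).trans (h1 0)
  have i : ∀ c : ℝ, Integrable (fun w : Canonical T A p => φ (w.2 u + c)) (P.restrict B) := fun c =>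
    .of_bound (hφ.continuous.measurable.comp (by fun_prop)).aestronglyMeasurable K
      (.of_forall fun w => hK _)
  have i' : Integrable (fun w : Canonical T A p => deriv φ (w.2 u + h * v)) (P.restrict B) :=
    .of_bound (hφ.deriv.continuous.measurable.comp (by fun_prop)).aestronglyMeasurable C
      (.of_forall fun w => h1 _)
  rw [← integral_const_mul, ← integral_sub (i _) (i _),
    ← integral_sub (f := fun w => φ (w.2 u + h * v) - φ (w.2 u + h * u)) ((i _).sub (i _))
      (i'.const_mul _)]
  have hb := norm_integral_le_of_norm_le_const (μ := P.restrict B)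
    (f := fun w => φ (w.2 u + h * v) - φ (w.2 u + h * u) -
      h * (v - u) * deriv φ (w.2 u + h * v)) (C := C * |h| * (v - u) * (|h| * (v - u)))
    (.of_forall fun w => by
      have := hφ.abs_sub_sub_le h2 (w.2 u + h * u) (w.2 u + h * v)
      rw [show w.2 u + h * v - (w.2 u + h * u) = h * (v - u) by ring, abs_mul,
        abs_of_nonneg huv'] at this
      rw [Real.norm_eq_abs]
      exact this.trans_eq (by ring))
  refine hb.trans (mul_le_of_le_one_right (by positivity) ?_)
  rw [measureReal_restrict_apply_univ]
  exact measureReal_le_one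

/-- Replaces `X_r` by `X_u` inside `φ'`. Path regularity is not quantified; instead the martingale
problem for `φ'(· + h v)` controls the change of the expectation over `B`, which is why `B` must be
known at time `u` and a third derivative enters. -/
theorem abs_integral_state_sub_le (hsolve : SolvesMartingaleProblem σ P)
    (ha : Integrable (fun y => y.2.2) (jointMeasure P)) (hφ : TestFunction φ)
    (h1 : ∀ x, |deriv φ x| ≤ C) (h2 : ∀ x, |deriv (deriv φ) x| ≤ C)
    (h3 : ∀ x, |deriv (deriv (deriv φ)) x| ≤ C) {u v : Time T} (huv : u ≤ v)
    {B : Set (Canonical T A p)} (hB : MeasurableSet[canonicalFiltration T A p u] B) :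
    |(∫ y in B ×ˢ (Prod.fst ⁻¹' Ioc u v), deriv φ (y.1.2 y.2.1 + h * v) ∂jointMeasure P) -
      (v - u) * ∫ w in B, deriv φ (w.2 u + h * v) ∂P| ≤
      C * (v - u) * ∫ y in univ ×ˢ (Prod.fst ⁻¹' Ioc u v),
        (|y.2.2| + |h| + 1 / 2 * σ ^ 2) ∂jointMeasure P := by
  have hB' : MeasurableSet B := (canonicalFiltration T A p).le u _ hB
  have huv' : 0 ≤ (v : ℝ) - u := sub_nonneg.2 huv
  have hC0 : 0 ≤ C := (abs_nonneg _).trans (h1 0)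
  set N := ∫ y in univ ×ˢ (Prod.fst ⁻¹' Ioc u v), (|y.2.2| + |h| + 1 / 2 * σ ^ 2) ∂jointMeasure P
  have hk : Measurable (fun y : Canonical T A p × Time T => deriv φ (y.1.2 y.2 + h * v)) :=
    hφ.deriv.continuous.measurable.comp ((measurable_eval_path.comp (by fun_prop : Measurable
      (fun y : Canonical T A p × Time T => (y.1.2, y.2)))).add_const _)
  have hF := setIntegral_jointMeasure_time P hk (fun y => h1 _) hB'
    (measurableSet_Ioc (a := u) (b := v))
  have hr : ∀ r ∈ Ioc u v, |(∫ w in B, deriv φ (w.2 r + h * v) ∂P) -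
      ∫ w in B, deriv φ (w.2 u + h * v) ∂P| ≤ C * N := by
    intro r hr
    rw [hsolve _ (hφ.deriv.comp_add_const (h * v)) u r hr.1.le B hB, ← integral_const_mul]
    refine abs_setIntegral_le_of_le (measurable_fst measurableSet_Ioc)
      (preimage_mono (Ioc_subset_Ioc_right hr.2)) hB'
      ((integrable_weight ha σ h).const_mul _) (fun y => by positivity) (fun y _ => ?_)
    have e : deriv (fun x => deriv φ (x + h * v)) = fun x => deriv (deriv φ) (x + h * v) := by
      ext x; exact deriv_comp_add_const _ _ _
    have e' : deriv (fun x => deriv (deriv φ) (x + h * v)) =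
        fun x => deriv (deriv (deriv φ)) (x + h * v) := by
      ext x; exact deriv_comp_add_const _ _ _
    rw [e, e']
    refine (abs_add_le _ _).trans ?_
    rw [abs_mul, abs_mul, abs_of_nonneg (by positivity : 0 ≤ 1 / 2 * σ ^ 2)]
    calc _ ≤ |y.2.2| * C + 1 / 2 * σ ^ 2 * C := by
          gcongr
          · exact h2 _
          · exact h3 _
      _ ≤ C * (|y.2.2| + |h| + 1 / 2 * σ ^ 2) := by nlinarith [mul_nonneg hC0 (abs_nonneg h)]
  have hvol : (timeMeasure T).real (Ioc u v) = v - u := by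
    rw [measureReal_def, timeMeasure_Ioc, ENNReal.toReal_ofReal huv']
  have hint : IntegrableOn (fun r => ∫ w in B, deriv φ (w.2 r + h * v) ∂P) (Ioc u v)
      (timeMeasure T) := by
    refine Integrable.of_bound (C := C) ?_ (.of_forall fun r => ?_)
    · exact (hk.stronglyMeasurable.integral_prod_left (μ := P.restrict B)).aestronglyMeasurable
    · refine (norm_integral_le_of_norm_le_const (.of_forall fun w => h1 _)).trans ?_
      refine mul_le_of_le_one_right hC0 ?_
      rw [measureReal_restrict_apply_univ]
      exact measureReal_le_one
  have hconst : (v - u) * ∫ w in B, deriv φ (w.2 u + h * v) ∂P =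
      ∫ r in Ioc u v, ∫ w in B, deriv φ (w.2 u + h * v) ∂P ∂timeMeasure T := by
    rw [setIntegral_const, hvol, smul_eq_mul]
  rw [hF, hconst, ← integral_sub hint (integrable_const _)]
  refine (norm_setIntegral_le_of_norm_le_const (f := fun r =>
    (∫ w in B, deriv φ (w.2 r + h * v) ∂P) - ∫ w in B, deriv φ (w.2 u + h * v) ∂P)
    (measure_lt_top _ _) hr).trans_eq ?_
  rw [hvol]; ring

theorem abs_shift_increment_le (hsolve : SolvesMartingaleProblem σ P)
    (ha : Integrable (fun y => y.2.2) (jointMeasure P)) (hφ : TestFunction φ)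
    (h1 : ∀ x, |deriv φ x| ≤ C) (h2 : ∀ x, |deriv (deriv φ) x| ≤ C)
    (h3 : ∀ x, |deriv (deriv (deriv φ)) x| ≤ C) {u v : Time T} (huv : u ≤ v)
    {B : Set (Canonical T A p)} (hB : MeasurableSet[canonicalFiltration T A p u] B) :
    |(∫ w in B, φ (w.2 v + h * v) ∂P) - (∫ w in B, φ (w.2 u + h * u) ∂P) -
      ∫ y in B ×ˢ (Prod.fst ⁻¹' Ioc u v), ((y.2.2 + h) * deriv φ (y.1.2 y.2.1 + h * y.2.1) +
          1 / 2 * σ ^ 2 * deriv (deriv φ) (y.1.2 y.2.1 + h * y.2.1)) ∂jointMeasure P| ≤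
      3 * C * |h| * (v - u) * ∫ y in univ ×ˢ (Prod.fst ⁻¹' Ioc u v),
        (|y.2.2| + |h| + 1 / 2 * σ ^ 2) ∂jointMeasure P := by
  have m0 := measurable_state (T := T) (A := A) (p := p)
  have hB' : MeasurableSet B := (canonicalFiltration T A p).le u _ hB
  have huv' : 0 ≤ (v : ℝ) - u := sub_nonneg.2 huv
  have hC0 : 0 ≤ C := (abs_nonneg _).trans (h1 0)
  have tA := abs_integral_frozen_sub_le (σ := σ) (h := h) ha hφ h1 h2 h3 huv hB'
  have tB := (abs_integral_taylor_le (P := P) (h := h) hφ h1 h2 huv B).trans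
    (mul_le_mul_of_nonneg_left (mul_le_integral_weight ha σ h huv) (by positivity))
  have tC := mul_le_mul_of_nonneg_left
    -- The martingale identity for the frozen function `φ(· + h v)` is exact but has drift `a`, not
    -- `a + h`. The missing term `h ∫ φ'` is matched, up to the errors `tB` and `tC`, by the change
    -- from `φ(X_u + h u)` to `φ(X_u + h v)`; `tA` then unfreezes the generator.
    (abs_integral_state_sub_le (h := h) hsolve ha hφ h1 h2 h3 huv hB) (abs_nonneg h)
  rw [← abs_mul] at tC
  have e := hsolve _ (hφ.comp_add_const (h * v)) u v huv B hB
  have e1 : deriv (fun x => φ (x + h * v)) = fun x => deriv φ (x + h * v) := by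
    ext x; exact deriv_comp_add_const _ _ _
  have e2 : deriv (fun x => deriv φ (x + h * v)) = fun x => deriv (deriv φ) (x + h * v) := by
    ext x; exact deriv_comp_add_const _ _ _
  rw [e1, e2] at e
  have iφ : Integrable (fun y : Canonical T A p × (Time T × ℝ) => deriv φ (y.1.2 y.2.1 + h * v))
      (jointMeasure P) :=
    .of_bound (hφ.deriv.continuous.measurable.comp (by fun_prop)).aestronglyMeasurable C
      (.of_forall fun w => h1 _)
  have split : ∫ y in B ×ˢ (Prod.fst ⁻¹' Ioc u v), ((y.2.2 + h) * deriv φ (y.1.2 y.2.1 + h * v) +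
          1 / 2 * σ ^ 2 * deriv (deriv φ) (y.1.2 y.2.1 + h * v)) ∂jointMeasure P =
      (∫ y in B ×ˢ (Prod.fst ⁻¹' Ioc u v), (y.2.2 * deriv φ (y.1.2 y.2.1 + h * v) +
          1 / 2 * σ ^ 2 * deriv (deriv φ) (y.1.2 y.2.1 + h * v)) ∂jointMeasure P) +
      h * ∫ y in B ×ˢ (Prod.fst ⁻¹' Ioc u v), deriv φ (y.1.2 y.2.1 + h * v) ∂jointMeasure P := by
    have i1 := integrable_generator (τ := fun y => y.1.2 y.2.1 + h * v) ha σ 0 (by fun_prop) hφ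
    simp only [add_zero] at i1
    rw [← integral_const_mul]
    refine Eq.trans ?_ (integral_add i1.integrableOn (iφ.const_mul h).integrableOn)
    congr 1
    ext y
    ring
  rw [abs_le] at tA tB tC ⊢
  constructor
  · nlinarith [tA.1, tB.1, tC.2]
  · nlinarith [tA.2, tB.2, tC.1]

theorem shift_increment_eq (hsolve : SolvesMartingaleProblem σ P)
    (ha : Integrable (fun y => y.2.2) (jointMeasure P)) (hφ : TestFunction φ) (h : ℝ)
    {s t : Time T} (hst : s ≤ t)
    {B : Set (Canonical T A p)} (hB : MeasurableSet[canonicalFiltration T A p s] B) :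
    (∫ w in B, φ (w.2 t + h * t) ∂P) - (∫ w in B, φ (w.2 s + h * s) ∂P) =
      ∫ y in B ×ˢ (Prod.fst ⁻¹' Ioc s t), ((y.2.2 + h) * deriv φ (y.1.2 y.2.1 + h * y.2.1) +
          1 / 2 * σ ^ 2 * deriv (deriv φ) (y.1.2 y.2.1 + h * y.2.1)) ∂jointMeasure P := by
  have m0 := measurable_state (T := T) (A := A) (p := p)
  have m1 := measurable_time (T := T) (A := A) (p := p)
  obtain ⟨C₁, h1⟩ := hφ.deriv.exists_bound
  obtain ⟨C₂, h2⟩ := hφ.deriv.deriv.exists_bound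
  obtain ⟨C₃, h3⟩ := hφ.deriv.deriv.deriv.exists_bound
  set C := max C₁ (max C₂ C₃)
  replace h1 : ∀ x, |deriv φ x| ≤ C := fun x => (h1 x).trans (le_max_left _ _)
  replace h2 : ∀ x, |deriv (deriv φ) x| ≤ C := fun x =>
    (h2 x).trans ((le_max_left _ _).trans (le_max_right _ _))
  replace h3 : ∀ x, |deriv (deriv (deriv φ)) x| ≤ C := fun x =>
    (h3 x).trans ((le_max_right _ _).trans (le_max_right _ _))
  have hB' : MeasurableSet B := (canonicalFiltration T A p).le s _ hB
  set ψ : Canonical T A p × (Time T × ℝ) → ℝ := fun y =>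
    (y.2.2 + h) * deriv φ (y.1.2 y.2.1 + h * y.2.1) +
      1 / 2 * σ ^ 2 * deriv (deriv φ) (y.1.2 y.2.1 + h * y.2.1)
  have hψ : Integrable ψ (jointMeasure P) :=
    integrable_generator (τ := fun y => y.1.2 y.2.1 + h * y.2.1) ha σ h (by fun_prop) hφ
  have hadd : ∀ (B : Set (Canonical T A p)), MeasurableSet B →
      ∀ ξ : Canonical T A p × (Time T × ℝ) → ℝ, Integrable ξ (jointMeasure P) →
      ∀ u v : Time T, s ≤ u → u ≤ v →
        ∫ y in B ×ˢ (Prod.fst ⁻¹' Ioc u v), ξ y ∂jointMeasure P =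
        (∫ y in B ×ˢ (Prod.fst ⁻¹' Ioc s v), ξ y ∂jointMeasure P) -
          ∫ y in B ×ˢ (Prod.fst ⁻¹' Ioc s u), ξ y ∂jointMeasure P := by
    intro B hB ξ hξ u v hu huv
    have hdisj : Disjoint (B ×ˢ (Prod.fst ⁻¹' Ioc s u : Set (Time T × ℝ)))
        (B ×ˢ (Prod.fst ⁻¹' Ioc u v)) := by
      rw [Set.disjoint_left]
      rintro y ⟨-, h1⟩ ⟨-, h2⟩
      exact (not_lt.2 h1.2) h2.1
    rw [← Ioc_union_Ioc_eq_Ioc hu huv, preimage_union, prod_union,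
      setIntegral_union hdisj (hB.prod (measurable_fst measurableSet_Ioc)) hξ.integrableOn
      hξ.integrableOn]
    ring
  have := eq_zero_of_abs_sub_le_mul (C := 3 * C * |h|)
    (F := fun v => (∫ w in B, φ (w.2 v + h * v) ∂P) -
      ∫ y in B ×ˢ (Prod.fst ⁻¹' Ioc s v), ψ y ∂jointMeasure P)
    (N := fun v => ∫ y in univ ×ˢ (Prod.fst ⁻¹' Ioc s v),
      (|y.2.2| + |h| + 1 / 2 * σ ^ 2) ∂jointMeasure P) hst (fun u v hu huv => by
      have := abs_shift_increment_le (h := h) hsolve ha hφ h1 h2 h3 huv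
        -- Events known at `s` are known at every later `u`, so the one-interval bound applies on
        -- all subintervals with the same `B`.
        ((canonicalFiltration T A p).mono hu _ hB)
      rw [hadd _ hB' _ hψ u v hu huv, hadd _ .univ _ (integrable_weight ha σ h) u v hu huv] at this
      refine le_trans (le_of_eq ?_) this
      congr 1
      ring)
  simp only [Ioc_self, preimage_empty, prod_empty, setIntegral_empty, sub_zero] at this
  linarith

end Error

/-! ### Games with drift equal to the control and constant volatility -/

namespace MFGData

variable {T : ℝ} {D : MFGData T} {σ : ℝ}

theorem mgFunctional_eq (hb : ∀ t x m a, D.b t x m a = a) (hσ : ∀ t x m a, D.sigma t x m a = σ)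
    (μ : Measure (PathSpace T)) (φ : ℝ → ℝ) (t : Time T) (w : D.Om) :
    D.mgFunctional μ φ t w = φ (w.2 t) - ∫ z in {z : Time T × ℝ | z.1 ≤ t},
      (z.2 * deriv φ (w.2 z.1) + 1 / 2 * σ ^ 2 * deriv (deriv φ) (w.2 z.1)) ∂w.1.1 := by
  simp only [mgFunctional, generator, hb, hσ]

theorem integrable_control_of_mem_admissible (hp : 1 ≤ D.p) {μ : Measure (PathSpace T)}
    {P : Measure D.Om} (hP : P ∈ D.admissible μ) :
    Integrable (fun y => y.2.2) (jointMeasure P) := by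
  have := hP.1
  exact integrable_control P hp hP.2.2.1

theorem solvesMartingaleProblem_of_mem_admissible (hb : ∀ t x m a, D.b t x m a = a)
    (hσ : ∀ t x m a, D.sigma t x m a = σ) (hp : 1 ≤ D.p) {μ : Measure (PathSpace T)}
    {P : Measure D.Om} (hP : P ∈ D.admissible μ) : SolvesMartingaleProblem σ P := by
  have := hP.1
  have ha := integrable_control_of_mem_admissible hp hP
  intro φ hφ s t hst B hB
  have hB' : MeasurableSet B := (canonicalFiltration T D.A D.p).le s _ hB
  obtain ⟨K, hK⟩ := hφ.exists_bound
  have hk : ∀ r : Time T, Integrable (fun w : D.Om => φ (w.2 r)) P := fun r =>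
    .of_bound (hφ.continuous.measurable.comp (measurable_eval_state r)).aestronglyMeasurable K
      (.of_forall fun w => hK _)
  have hψ := integrable_generator (τ := fun y => y.1.2 y.2.1) ha σ 0 measurable_state hφ
  simp only [add_zero] at hψ
  have h := setIntegral_sub_compensator P hk hψ hst hB'
  have hM := (hP.2.2.2 φ hφ.contDiff hφ.hasCompactSupport).setIntegral_eq hst hB
  simp only [mgFunctional_eq hb hσ] at hM
  rw [← hM, sub_self] at h
  linarith

theorem mgFunctional_shift (hb : ∀ t x m a, D.b t x m a = a)
    (hσ : ∀ t x m a, D.sigma t x m a = σ) (hA : D.A = univ) (hp : 1 ≤ D.p) (h : ℝ)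
    (μ : Measure (PathSpace T)) (φ : ℝ → ℝ) (t : Time T) (w : D.Om) :
    D.mgFunctional μ φ t (shift hA hp h w) = φ (w.2 t + h * t) -
      ∫ z in {z : Time T × ℝ | z.1 ≤ t}, ((z.2 + h) * deriv φ (w.2 z.1 + h * z.1) +
        1 / 2 * σ ^ 2 * deriv (deriv φ) (w.2 z.1 + h * z.1)) ∂w.1.1 := by
  rw [mgFunctional_eq hb hσ, shift_fst, (measurableEmbedding_shift_control h).setIntegral_map]
  rfl

theorem map_shift_mem_admissible (hb : ∀ t x m a, D.b t x m a = a)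
    (hσ : ∀ t x m a, D.sigma t x m a = σ) (hA : D.A = univ) (hp : 1 ≤ D.p) (h : ℝ)
    {μ : Measure (PathSpace T)} {P : Measure D.Om} (hP : P ∈ D.admissible μ) :
    P.map (shift hA hp h) ∈ D.admissible μ := by
  have := hP.1
  have ha := integrable_control_of_mem_admissible hp hP
  have hsolve := solvesMartingaleProblem_of_mem_admissible hb hσ hp hP
  have hS := measurable_shift (T := T) hA hp h
  have hprob : IsProbabilityMeasure (P.map (shift hA hp h)) :=
    Measure.isProbabilityMeasure_map hS.aemeasurable
  have hmom : Measurable fun w : D.Om => ∫⁻ z, ‖z.2‖ₑ ^ D.p ∂w.1.1 :=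
    Measurable.lintegral_kernel (κ := controlKernel T D.A D.p)
      (f := fun z : Time T × ℝ => ‖z.2‖ₑ ^ D.p) (by fun_prop)
  -- Adaptedness does not involve the law, so it is inherited from the martingale under `P`.
  refine ⟨hprob, ?_, ?_, fun φ hφ₁ hφ₂ => ⟨(hP.2.2.2 φ hφ₁ hφ₂).1, fun s t hst => ?_⟩⟩
  · rw [Measure.map_map (measurable_eval_state _) hS, ← hP.2.1]
    congr 1
    ext w
    change w.2 D.startTime + h * 0 = w.2 D.startTime
    ring
  · rw [lintegral_map hmom hS]
    refine (lintegral_mono fun w => w.1.lintegral_map_shift_le hp h).trans_lt ?_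
    rw [lintegral_const_mul _ (by fun_prop), lintegral_add_right _ measurable_const,
      lintegral_const, measure_univ, mul_one]
    exact shift_moment_bound_lt_top hp h hP.2.2.1
  · have hφ : TestFunction φ := ⟨hφ₁, hφ₂⟩
    have hadapt := (hP.2.2.2 φ hφ₁ hφ₂).1
    have hmeas : ∀ r, StronglyMeasurable (D.mgFunctional μ φ r) := fun r =>
      (hadapt r).mono ((canonicalFiltration T D.A D.p).le r)
    obtain ⟨K, hK⟩ := hφ.exists_bound
    have hk : ∀ r : Time T, Integrable (fun w : D.Om => φ (w.2 r + h * r)) P := fun r =>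
      .of_bound (hφ.continuous.measurable.comp
        ((measurable_eval_state r).add_const _)).aestronglyMeasurable K (.of_forall fun w => hK _)
    have hψ := integrable_generator (τ := fun y => y.1.2 y.2.1 + h * y.2.1) ha σ h
      (measurable_state.add (measurable_time.const_mul h)) hφ
    have hint : ∀ r, Integrable (D.mgFunctional μ φ r) (P.map (shift hA hp h)) := by
      intro r
      rw [integrable_map_measure (hmeas r).aestronglyMeasurable hS.aemeasurable]
      refine ((hk r).sub (integrable_compensator hψ r)).congr (.of_forall fun w => ?_)
      exact (mgFunctional_shift hb hσ hA hp h μ φ r w).symm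
    refine (ae_eq_condExp_of_forall_setIntegral_eq ((canonicalFiltration T D.A D.p).le s)
      (hint t) (fun _ _ _ => (hint s).integrableOn) (fun B hB _ => ?_)
      (hadapt s).aestronglyMeasurable).symm
    have hB' : MeasurableSet B := (canonicalFiltration T D.A D.p).le s _ hB
    have hSB := measurableSet_preimage_shift hA hp h s hB
    rw [setIntegral_map hB' (hmeas s).aestronglyMeasurable hS.aemeasurable,
      setIntegral_map hB' (hmeas t).aestronglyMeasurable hS.aemeasurable]
    simp only [mgFunctional_shift hb hσ hA hp h]
    have h1 := setIntegral_sub_compensator P hk hψ hst (hS hB')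
    have h2 := shift_increment_eq hsolve ha hφ h hst hSB
    rw [h2, sub_self] at h1
    exact (sub_eq_zero.1 h1).symm

end MFGData

/-! ### The expected state -/

theorem TestFunction.scale {φ : ℝ → ℝ} (hφ : TestFunction φ) {c : ℝ} (hc : c ≠ 0) :
    TestFunction (fun x => c⁻¹ * φ (c * x)) :=
  ⟨contDiff_const.mul (hφ.contDiff.comp (by fun_prop)),
    (hφ.hasCompactSupport.comp_homeomorph (Homeomorph.mulLeft₀ c hc)).mul_left⟩

theorem deriv_scale {φ : ℝ → ℝ} {c : ℝ} (hc : c ≠ 0) :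
    deriv (fun x => c⁻¹ * φ (c * x)) = fun x => deriv φ (c * x) := by
  ext x
  rw [deriv_const_mul_field, deriv_comp_mul_left, smul_eq_mul, inv_mul_cancel_left₀ hc]

theorem exists_testFunction_eventuallyEq_id : ∃ χ, TestFunction χ ∧ χ =ᶠ[𝓝 0] id := by
  let b : ContDiffBump (0 : ℝ) := ⟨1, 2, one_pos, one_lt_two⟩
  refine ⟨fun x => x * b x, ⟨contDiff_id.mul b.contDiff, b.hasCompactSupport.mul_left⟩, ?_⟩
  filter_upwards [b.eventuallyEq_one] with x hx
  simp [hx]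

/-- The test functions are `x ↦ c⁻¹ χ(c x)` with `χ` the identity near 0 and `c → 0`. Their first
derivatives `χ'(c x)` are uniformly bounded and tend to 1, while the second derivatives `c χ''(c x)`
tend to 0, so only the drift survives. -/
theorem SolvesMartingaleProblem.integral_sub_eq {σ : ℝ} {P : Measure (Canonical T A p)}
    [IsProbabilityMeasure P] (hsolve : SolvesMartingaleProblem σ P)
    (ha : Integrable (fun y => y.2.2) (jointMeasure P)) {s t : Time T} (hst : s ≤ t)
    (hs : Integrable (fun w => w.2 s) P) (ht : Integrable (fun w => w.2 t) P) :
    (∫ w, w.2 t ∂P) - ∫ w, w.2 s ∂P =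
      ∫ y in univ ×ˢ (Prod.fst ⁻¹' Ioc s t), y.2.2 ∂jointMeasure P := by
  obtain ⟨χ, hχ, hid⟩ := exists_testFunction_eventuallyEq_id
  have hχ0 : χ 0 = 0 := hid.eq_of_nhds
  have hχ1 : deriv χ 0 = 1 := by rw [hid.deriv_eq, deriv_id]
  obtain ⟨C, hC⟩ := hχ.deriv.exists_bound
  obtain ⟨C', hC'⟩ := hχ.deriv.deriv.exists_bound
  set c : ℕ → ℝ := fun n => 1 / ((n : ℝ) + 1)
  have hc0 : ∀ n, 0 < c n := fun n => by positivity
  have hc1 : ∀ n, c n ≤ 1 := fun n => by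
    rw [div_le_one (by positivity)]
    linarith [n.cast_nonneg (α := ℝ)]
  have hc : Tendsto c atTop (𝓝 0) := tendsto_one_div_add_atTop_nhds_zero_nat
  have hcx : ∀ x, Tendsto (fun n => c n * x) atTop (𝓝 0) := fun x => by
    simpa using hc.mul_const x
  have hstate : ∀ r : Time T, Integrable (fun w : Canonical T A p => w.2 r) P →
      Tendsto (fun n => ∫ w, (c n)⁻¹ * χ (c n * w.2 r) ∂P) atTop (𝓝 (∫ w, w.2 r ∂P)) := by
    intro r hr
    refine tendsto_integral_of_dominated_convergence (fun w => C * |w.2 r|) (fun n => ?_)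
      (hr.abs.const_mul C) (fun n => .of_forall fun w => ?_) (.of_forall fun w => ?_)
    · exact ((hχ.continuous.measurable.comp
        ((measurable_eval_state r).const_mul _)).const_mul _).aestronglyMeasurable
    · have := hχ.abs_sub_le hC 0 (c n * w.2 r)
      rw [hχ0, sub_zero, sub_zero, abs_mul, abs_of_pos (hc0 n)] at this
      rw [Real.norm_eq_abs, abs_mul, abs_of_pos (inv_pos.2 (hc0 n))]
      calc _ ≤ (c n)⁻¹ * (C * (c n * |w.2 r|)) :=
            mul_le_mul_of_nonneg_left this (inv_pos.2 (hc0 n)).le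
        _ = C * |w.2 r| := by field_simp [(hc0 n).ne']
    · refine tendsto_const_nhds.congr' ?_
      -- For each outcome the approximation is eventually exact, since `c n * X_r` enters the region
      -- where `χ` is the identity.
      filter_upwards [(hcx (w.2 r)).eventually hid] with n hn
      rw [hn, id, inv_mul_cancel_left₀ (hc0 n).ne']
  have hgen : Tendsto (fun n => ∫ y in univ ×ˢ (Prod.fst ⁻¹' Ioc s t),
      (y.2.2 * deriv χ (c n * y.1.2 y.2.1) +
        1 / 2 * σ ^ 2 * (c n * deriv (deriv χ) (c n * y.1.2 y.2.1))) ∂jointMeasure P) atTop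
      (𝓝 (∫ y in univ ×ˢ (Prod.fst ⁻¹' Ioc s t), y.2.2 ∂jointMeasure P)) := by
    have m0 := measurable_state (T := T) (A := A) (p := p)
    refine tendsto_integral_of_dominated_convergence
      (fun y => |y.2.2| * C + 1 / 2 * σ ^ 2 * C') (fun n => ?_)
      (Integrable.integrableOn ((ha.abs.mul_const C).add (integrable_const _) :
        Integrable (fun y => |y.2.2| * C + 1 / 2 * σ ^ 2 * C') (jointMeasure P)))
      (fun n => .of_forall fun y => ?_) (.of_forall fun y => ?_)
    · have m1 := hχ.deriv.continuous.measurable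
      have m2 := hχ.deriv.deriv.continuous.measurable
      exact Measurable.aestronglyMeasurable (by fun_prop)
    · refine (abs_add_le _ _).trans ?_
      rw [abs_mul, abs_mul, abs_mul (c n), abs_of_pos (hc0 n),
        abs_of_nonneg (by positivity : 0 ≤ 1 / 2 * σ ^ 2)]
      have := mul_le_mul (hc1 n) (hC' (c n * y.1.2 y.2.1)) (abs_nonneg _) zero_le_one
      rw [one_mul] at this
      gcongr
      exact hC _
    · have l1 := ((hχ.deriv.continuous.tendsto 0).comp (hcx (y.1.2 y.2.1))).const_mul y.2.2
      have l2 := (hc.mul ((hχ.deriv.deriv.continuous.tendsto 0).comp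
        (hcx (y.1.2 y.2.1)))).const_mul (1 / 2 * σ ^ 2)
      have := l1.add l2
      rw [hχ1, mul_one, zero_mul, mul_zero, add_zero] at this
      exact this
  refine tendsto_nhds_unique ((hstate t ht).sub (hstate s hs)) (hgen.congr fun n => ?_)
  have h := hsolve _ (hχ.scale (hc0 n).ne') s t hst univ MeasurableSet.univ
  have e : deriv (fun x => deriv χ (c n * x)) = fun x => c n * deriv (deriv χ) (c n * x) := by
    ext x
    rw [deriv_comp_mul_left, smul_eq_mul]
  rw [deriv_scale (hc0 n).ne', e] at h
  simpa only [Measure.restrict_univ] using h.symm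

/-! ### Rewards -/

/-- Rewards here are nonpositive with integrable cost, so optimality can be tested as an inequality
between real numbers. -/
theorem extIntegral_neg_coe {Ω : Type*} [MeasurableSpace Ω] {P : Measure Ω} {k : Ω → ℝ}
    (hk : Integrable k P) (hk0 : ∀ w, 0 ≤ k w) :
    extIntegral P (fun w => ((-k w : ℝ) : EReal)) = ((-∫ w, k w ∂P : ℝ) : EReal) := by
  have h1 : ∀ w, ((-k w : ℝ) : EReal).toENNReal = 0 := fun w => by
    rw [EReal.real_coe_toENNReal, ENNReal.ofReal_eq_zero]
    linarith [hk0 w]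
  have h2 : ∀ w, (-((-k w : ℝ) : EReal)).toENNReal = ENNReal.ofReal (k w) := fun w => by
    rw [← EReal.coe_neg, neg_neg, EReal.real_coe_toENNReal]
  simp only [extIntegral, h1, h2, lintegral_zero]
  rw [← ofReal_integral_eq_lintegral_ofReal hk (.of_forall hk0),
    EReal.coe_ennreal_ofReal, max_eq_left (integral_nonneg hk0)]
  simp

theorem RelaxedControl.memLp_two (q : RelaxedControl T A 2) :
    MemLp (fun z : Time T × ℝ => z.2) 2 q.1 := by
  refine ⟨by fun_prop, ?_⟩
  rw [eLpNorm_lt_top_iff_lintegral_rpow_enorm_lt_top (by norm_num) (by norm_num)]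
  simpa using q.2.2.2

theorem memLp_two_control {P : Measure (Canonical T A p)} [IsFiniteMeasure P] (hp : p = 2)
    (hP : ∫⁻ w, ∫⁻ z, ‖z.2‖ₑ ^ p ∂w.1.1 ∂P < ⊤) :
    MemLp (fun y => y.2.2) 2 (jointMeasure P) := by
  subst hp
  refine ⟨by fun_prop, ?_⟩
  rw [eLpNorm_lt_top_iff_lintegral_rpow_enorm_lt_top (by norm_num) (by norm_num), jointMeasure,
    ENNReal.toReal_ofNat, Measure.lintegral_compProd (by fun_prop)]
  exact hP

theorem memLp_two_state {P : Measure (Canonical T A p)}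
    (hP : P.map Prod.snd ∈ FiniteMoment 2) (t : Time T) : MemLp (fun w => w.2 t) 2 P := by
  have h : MemLp (fun x : PathSpace T => x) 2 (P.map Prod.snd) := by
    refine ⟨by fun_prop, ?_⟩
    rw [eLpNorm_lt_top_iff_lintegral_rpow_enorm_lt_top (by norm_num) (by norm_num)]
    simpa using hP.2
  have h' : MemLp (fun w : Canonical T A p => w.2) 2 P := h.comp_of_map measurable_snd.aemeasurable
  exact h'.mono (measurable_eval_state t).aestronglyMeasurable
    (.of_forall fun w => w.2.norm_coe_le_norm t)

/-- The cost `(x_T + β)² + ∫ a² dΛ`. -/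
noncomputable def quadraticCost (β : ℝ) (t : Time T) (w : Canonical T A p) : ℝ :=
  (w.2 t + β) ^ 2 + ∫ z, z.2 ^ 2 ∂w.1.1

theorem quadraticCost_nonneg (β : ℝ) (t : Time T) (w : Canonical T A p) :
    0 ≤ quadraticCost β t w :=
  add_nonneg (sq_nonneg _) (integral_nonneg fun _ => sq_nonneg _)

theorem measurable_quadraticCost (β : ℝ) (t : Time T) :
    Measurable (quadraticCost β t : Canonical T A p → ℝ) := by
  refine (((measurable_eval_state t).add_const β).pow_const 2).add ?_
  exact (StronglyMeasurable.integral_kernel_prod_right' (κ := controlKernel T A p)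
    (f := fun y => y.2.2 ^ 2) (by fun_prop)).measurable

theorem integrable_quadraticCost {P : Measure (Canonical T A p)} [IsFiniteMeasure P] (β : ℝ)
    (t : Time T) (hX : MemLp (fun w => w.2 t) 2 P)
    (ha : MemLp (fun y => y.2.2) 2 (jointMeasure P)) :
    Integrable (quadraticCost β t) P :=
  (hX.add (memLp_const β)).integrable_sq.add (integrable_integral_control ha.integrable_sq)

/-- The coefficient of `h²` collects `t²` from the displacement of the state and `T` from the total
mass of the control. -/
theorem quadraticCost_shift (hT : 0 ≤ T) (hA : A = univ) (h β : ℝ) (t : Time T)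
    (w : Canonical T A 2) :
    quadraticCost β t (shift hA one_le_two h w) = quadraticCost β t w +
      (2 * h * (t * (w.2 t + β) + ∫ z, z.2 ∂w.1.1) + h ^ 2 * (t ^ 2 + T)) := by
  have hL := w.1.memLp_two
  have hint : ∫ z, z.2 ^ 2 ∂(shift hA one_le_two h w).1.1 =
      (∫ z, z.2 ^ 2 ∂w.1.1) + (2 * h * ∫ z, z.2 ∂w.1.1) + h ^ 2 * T := by
    rw [shift_fst, (measurableEmbedding_shift_control h).integral_map]
    have e : ∀ z : Time T × ℝ, (z.2 + h) ^ 2 = z.2 ^ 2 + 2 * h * z.2 + h ^ 2 := fun z => by ring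
    simp only [e]
    rw [integral_add (f := fun z : Time T × ℝ => z.2 ^ 2 + 2 * h * z.2)
      (hL.integrable_sq.add ((hL.integrable one_le_two).const_mul _)) (integrable_const _), integral_add hL.integrable_sq ((hL.integrable one_le_two).const_mul _),
      integral_const_mul, integral_const, measureReal_def, w.1.apply_univ,
      ENNReal.toReal_ofReal hT, smul_eq_mul]
    ring
  rw [quadraticCost, quadraticCost, hint, shift_snd_apply]
  ring

/-! ### Non-existence for the linear-quadratic game. -/

section LQ

variable {hT : 0 < T} {σ : ℝ} {init : Measure ℝ}

theorem lqGame_reward {μ : Measure (PathSpace T)} {P : Measure (lqGame T hT σ init).Om}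
    (hint : Integrable (quadraticCost (-(1 + T) / T *
        ∫ z, z ∂MFGData.marginal μ (lqGame T hT σ init).endTime) (lqGame T hT σ init).endTime) P) :
    (lqGame T hT σ init).reward μ P = ((-∫ w, quadraticCost (-(1 + T) / T *
        ∫ z, z ∂MFGData.marginal μ (lqGame T hT σ init).endTime)
        (lqGame T hT σ init).endTime w ∂P : ℝ) : EReal) := by
  rw [← extIntegral_neg_coe hint (quadraticCost_nonneg _ _), MFGData.reward]
  congr 1
  ext w
  have h : extIntegral w.1.1 (fun z => (((lqGame T hT σ init).f z.1 (w.2 z.1)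
      (MFGData.marginal μ z.1) z.2 : ℝ) : EReal)) = ((-∫ z, z.2 ^ 2 ∂w.1.1 : ℝ) : EReal) :=
    extIntegral_neg_coe (RelaxedControl.memLp_two w.1).integrable_sq fun z => sq_nonneg z.2
  rw [MFGData.pathReward, h, ← EReal.coe_add, quadraticCost, neg_add]
  rfl

theorem lqGame_not_exists_isRelaxedSolution (hmean : ∫ z, z ∂init ≠ 0) :
    ¬ ∃ P, (lqGame T hT σ init).IsRelaxedSolution P := by
  set D := lqGame T hT σ init
  rintro ⟨P, hmom, hadm, hopt⟩
  have hA : D.A = univ := rfl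
  have hp : (1 : ℝ) ≤ D.p := one_le_two
  have hprob : IsProbabilityMeasure P := hadm.1
  set μ := P.map Prod.snd
  set β : ℝ := -(1 + T) / T * ∫ z, z ∂MFGData.marginal μ D.endTime with hβ
  have hX : ∀ t, MemLp (fun w : D.Om => w.2 t) 2 P := memLp_two_state hmom
  have hX1 : ∀ t, Integrable (fun w : D.Om => w.2 t) P := fun t => (hX t).integrable one_le_two
  have ha : MemLp (fun y : D.Om × (Time T × ℝ) => y.2.2) 2 (jointMeasure P) :=
    memLp_two_control rfl hadm.2.2.1
  have ha1 := ha.integrable one_le_two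
  have hcost : Integrable (quadraticCost β D.endTime) P :=
    integrable_quadraticCost β D.endTime (hX _) ha
  have hlin : Integrable (fun w : D.Om => T * (w.2 D.endTime + β) + ∫ z, z.2 ∂w.1.1) P :=
    (((hX1 D.endTime).add (integrable_const β)).const_mul T).add (integrable_integral_control ha1)
  have hshift : ∀ h w, quadraticCost β D.endTime (shift hA hp h w) =
      quadraticCost β D.endTime w + (2 * h * (T * (w.2 D.endTime + β) + ∫ z, z.2 ∂w.1.1) +
        h ^ 2 * (T ^ 2 + T)) := fun h w => quadraticCost_shift hT.le hA h β D.endTime w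
  set K := ∫ w : D.Om, (T * (w.2 D.endTime + β) + ∫ z, z.2 ∂w.1.1) ∂P
  have hineq : ∀ h : ℝ, 0 ≤ 2 * h * K + h ^ 2 * (T ^ 2 + T) := by
    intro h
    have hS := measurable_shift (T := T) hA hp h
    have hint' : Integrable (fun w => quadraticCost β D.endTime (shift hA hp h w)) P := by
      simp only [hshift]
      exact hcost.add ((hlin.const_mul _).add (integrable_const _))
    -- The deviation is judged against the same frozen `μ`, so `β` does not change although the mean
    -- of the state does.
    have hle := hopt _ (MFGData.map_shift_mem_admissible (D := D) (σ := σ) (fun _ _ _ _ => rfl)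
      (fun _ _ _ _ => rfl) hA hp h hadm)
    rw [lqGame_reward hcost, lqGame_reward ((integrable_map_measure
      (measurable_quadraticCost _ _).aestronglyMeasurable hS.aemeasurable).2 hint'),
      EReal.coe_le_coe_iff, integral_map hS.aemeasurable
      (measurable_quadraticCost _ _).aestronglyMeasurable] at hle
    change -∫ w, quadraticCost β D.endTime (shift hA hp h w) ∂P ≤
      -∫ w, quadraticCost β D.endTime w ∂P at hle
    simp only [hshift] at hle
    rw [integral_add hcost (g := fun w => 2 * h * (T * (w.2 D.endTime + β) + ∫ z, z.2 ∂w.1.1) +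
        h ^ 2 * (T ^ 2 + T)) ((hlin.const_mul _).add (integrable_const _)),
      integral_add (hlin.const_mul _) (integrable_const _), integral_const_mul, integral_const,
      probReal_univ, one_smul] at hle
    linarith
  have hK : K = 0 := by
    have hpos : 0 < T ^ 2 + T := by positivity
    -- The minimiser of the quadratic in `h`.
    have := hineq (-K / (T ^ 2 + T))
    have e : 2 * (-K / (T ^ 2 + T)) * K + (-K / (T ^ 2 + T)) ^ 2 * (T ^ 2 + T) =
        -(K ^ 2 / (T ^ 2 + T)) := by
      field_simp
      ring
    rw [e] at this
    have h2 : K ^ 2 / (T ^ 2 + T) ≤ 0 := by linarith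
    rw [div_le_iff₀ hpos, zero_mul] at h2
    exact pow_eq_zero_iff two_ne_zero |>.1 (le_antisymm h2 (sq_nonneg K))
  have hse : D.startTime ≤ D.endTime := hT.le
  have hcontrol : ∫ w : D.Om, ∫ z, z.2 ∂w.1.1 ∂P = ∫ y, y.2.2 ∂jointMeasure P :=
    (Measure.integral_compProd ha1).symm
  have hdyn := (MFGData.solvesMartingaleProblem_of_mem_admissible (D := D) (σ := σ)
    (fun _ _ _ _ => rfl) (fun _ _ _ _ => rfl) hp hadm).integral_sub_eq ha1 hse (hX1 _) (hX1 _)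
  have hfull : ∫ y in univ ×ˢ (Prod.fst ⁻¹' Ioc D.startTime D.endTime), y.2.2 ∂jointMeasure P =
      ∫ y, y.2.2 ∂jointMeasure P := by
    rw [← setIntegral_univ (μ := jointMeasure P)]
    refine setIntegral_congr_set (ae_eq_univ.2 ?_)
    -- The half-open interval misses only time 0, which is null for the time marginal.
    have hc : (univ ×ˢ (Prod.fst ⁻¹' Ioc D.startTime D.endTime))ᶜ ⊆
        (univ : Set D.Om) ×ˢ (Prod.fst ⁻¹' {D.startTime} : Set (Time T × ℝ)) := by
      intro y hy
      refine ⟨mem_univ _, ?_⟩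
      by_contra hne
      exact hy ⟨mem_univ _, lt_of_le_of_ne y.2.1.2.1 (Ne.symm hne), y.2.1.2.2⟩
    refine measure_mono_null hc ?_
    rw [jointMeasure, Measure.compProd_apply_prod .univ (measurable_fst (measurableSet_singleton _))]
    simp_rw [controlKernel_apply, RelaxedControl.apply_preimage_fst _ (measurableSet_singleton _),
      timeMeasure_singleton, lintegral_zero]
  have hinit : ∫ w : D.Om, w.2 D.startTime ∂P = ∫ z, z ∂init := by
    have : init = P.map (fun w => w.2 D.startTime) := hadm.2.1.symm
    rw [this, integral_map (measurable_eval_state _).aemeasurable (by fun_prop)]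
  have hmarg : ∫ z, z ∂MFGData.marginal μ D.endTime = ∫ w : D.Om, w.2 D.endTime ∂P := by
    have m1 : Measurable (fun x : PathSpace T => x D.endTime) :=
      (continuous_eval_const _).measurable
    rw [MFGData.marginal, Measure.map_map m1 measurable_snd,
      integral_map (m1.comp measurable_snd).aemeasurable (by fun_prop)]
    rfl
  have hKval : K = T * ((∫ w : D.Om, w.2 D.endTime ∂P) + β) + ∫ w : D.Om, ∫ z, z.2 ∂w.1.1 ∂P := by
    change ∫ w : D.Om, (T * (w.2 D.endTime + β) + ∫ z, z.2 ∂w.1.1) ∂P = _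
    rw [integral_add (f := fun w : D.Om => T * (w.2 D.endTime + β))
      (g := fun w : D.Om => ∫ z, z.2 ∂w.1.1)
      (((hX1 D.endTime).add (integrable_const β)).const_mul T) (integrable_integral_control ha1), integral_const_mul,
      integral_add (hX1 _) (integrable_const _), integral_const, probReal_univ, one_smul]
  rw [hfull, ← hcontrol, hinit] at hdyn
  -- With `M` the mean of `X_T` and `m₀` the initial mean, this reads `0 = T (M + c M) + (M - m₀)`,
  -- and `T (1 + c) = -1`.
  rw [hK, hβ, hmarg, ← hdyn] at hKval
  have hT0 : T ≠ 0 := hT.ne'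
  field_simp at hKval
  exact hmean (by linarith)

end LQ

end RelaxedMFG
open RelaxedMFG in
theorem mainTheorem7 :
    (∀ (T : ℝ) (hT : 0 < T) (σ : ℝ) (init : Measure ℝ),
      init ∈ FiniteMoment 2 → ∫ z, z ∂init ≠ 0 →
        (∀ pσ ∈ Set.Icc (0 : ℝ) 2, (lqGame T hT σ init).StandingExceptGap 2 pσ) ∧
        (lqGame T hT σ init).ConvexityAssumption ∧
        (¬ ∃ P, (lqGame T hT σ init).IsRelaxedSolution P) ∧
        (¬ ∃ P, (lqGame T hT σ init).IsStrictSolution P)) ∧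
    (¬ ∀ (T : ℝ) (D : MFGData T) (pσ : ℝ),
      D.StandingExceptGap D.p pσ → D.ConvexityAssumption →
        ∃ P, D.IsRelaxedSolution P) := by
  refine ⟨fun T hT σ init hinit hmean => ⟨fun pσ hpσ => lqGame_standingExceptGap T hT σ init hinit
    hpσ, lqGame_convexityAssumption T hT σ init, lqGame_not_exists_isRelaxedSolution hmean,
    fun ⟨P, hP⟩ => lqGame_not_exists_isRelaxedSolution hmean ⟨P, hP.1⟩⟩, fun H => ?_⟩
  -- A deterministic instance suffices as counterexample: `T = 1`, zero volatility, start at 1.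
  have hinit : Measure.dirac (1 : ℝ) ∈ FiniteMoment 2 := ⟨inferInstance, by simp⟩
  exact lqGame_not_exists_isRelaxedSolution (hT := one_pos) (σ := 0) (init := Measure.dirac 1)
    (by simp) (H 1 _ 0
      (lqGame_standingExceptGap 1 one_pos 0 _ hinit ⟨le_rfl, zero_le_two⟩)
      (lqGame_convexityAssumption 1 one_pos 0 _))
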